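/- Let $\mathbb K=\mathbb C$ (or $\mathbb R$), let $M$ be a smooth manifold and write $C^\infty(\cdot)$ for smooth $\mathbb K$-valued functions, $\Gamma(T\,\cdot)$ for the derivations of $C^\infty(\cdot)$ (smooth vector fields). Let $A$ be a transitive Lie algebroid over $M$: a finitely generated projective $C^\infty(M)$-module with a Lie bracket and a surjective $C^\infty(M)$-linear Lie morphism $\rho:A\to\Gamma(TM)$ (the anchor) such that $[X,fY]=f[X,Y]+(\rho(X)f)\,Y$. Let $L=\ker\rho$. For open $U\subset M$ let $A_U$ be the restriction of $A$ to $U$ (sections over $U$ of the vector bundle defined by $A$) and $L_U=\ker\rho_U$. Let $\Omega^q(A,L)$ be the space of $C^\infty(M)$-multilinear alternating maps $A^q\to L$, and $\hat d$ its differential given by the Koszul formula for the adjoint representation of $A$ on $L$, $$(\hat d\omega)(X_0,\dots,X_q)=\sum_i(-1)^i[X_i,\omega(\dots,\widehat{X_i},\dots)]+\sum_{i<j}(-1)^{i+j}\omega([X_i,X_j],\dots,\widehat{X_i},\dots,\widehat{X_j},\dots).$$ Let $\mathfrak g$ be a finite-dimensional Lie algebra over $\mathbb K$. For $U\subset M$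 open let $\mathrm{TLA}(U,\mathfrak g)=\Gamma(TU)\oplus\Gamma(U\times\mathfrak g)$ be the trivial Lie algebroid, with anchor $X\oplus\gamma\mapsto X$ and bracket $[X\oplus\gamma,Y\oplus\eta]=[X,Y]\oplus(X\cdot\eta-Y\cdot\gamma+[\gamma,\eta])$. Let $\Omega^\bullet_{\mathrm{TLA}}(U,\mathfrak g)=\Omega^\bullet(U)\otimes\Lambda^\bullet\mathfrak g^*\otimes\mathfrak g$, i.e. the $C^\infty(U)$-multilinear alternating maps from $\mathrm{TLA}(U,\mathfrak g)$ to $\Gamma(U\times\mathfrak g)$, with its graded Lie bracket (exterior product of forms combined with the bracket of $\mathfrak g$) and the differential $\hat d_{\mathrm{TLA}}=d+s'$, where $d$ is the de Rham differential and $s'$ the Chevalley–Eilenberg differential for the adjoint representation of $\mathfrak g$. A local trivialization of $A$ is a triple $(U,\Psi,\nabla^0)$ in which $\Psi:\Gamma(U\times\mathfrak g)\to L_U$ is an isomorphism of Lie algebras and $C^\infty(U)$-modules, $\nabla^0:\Gamma(TU)\to A_U$ is a $C^\infty(U)$-linear Lie morphism with $\rho_U\circ\nabla^0=\mathrm{id}$,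 and $[\nabla^0_X,\Psi(\gamma)]=\Psi(X\cdot\gamma)$. It gives the isomorphism $S:\mathrm{TLA}(U,\mathfrak g)\to A_U$, $S(X\oplus\gamma)=\nabla^0_X+\Psi(\gamma)$, and the local expression $\omega_{\mathrm{loc}}=\Psi^{-1}\circ\omega|_U\circ S\in\Omega^q_{\mathrm{TLA}}(U,\mathfrak g)$ of $\omega\in\Omega^q(A,L)$. Let $(U_i,\Psi_i,\nabla^{0,i})_{i\in I}$ be a family of local trivializations of $A$ (for instance one whose $U_i$ cover $M$). On $U_{ij}=U_i\cap U_j$, with all trivializations restricted to $U_{ij}$, put $\alpha^i_j=\Psi_i^{-1}\circ\Psi_j$, $s_i^j=S_j^{-1}\circ S_i$ and $\hat\alpha^{\,i}_j(\theta)=\alpha^i_j\circ\theta\circ s_i^j$ for $\theta\in\Omega^\bullet_{\mathrm{TLA}}(U_{ij},\mathfrak g)$. Then: 1. for every $i$, every $q\ge 0$ and every $\omega\in\Omega^q(A,L)$, with $\omega_{\mathrm{loc}}$, $\Psi$, $S$ those of $(U_i,\Psi_i,\nabla^{0,i})$, one has $\hat d_{\mathrm{TLA}}\,\omega_{\mathrm{loc}}=\Psi^{-1}\circ(\hat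 d\omega)|_U\circ S$; 2. for all $i,j$ and every $\omega\in\Omega^q(A,L)$, the local expressions $\omega^i_{\mathrm{loc}}$, $\omega^j_{\mathrm{loc}}$ satisfy on $U_{ij}$ the relation $\hat d_{\mathrm{TLA}}\,\omega^i_{\mathrm{loc}}=\hat\alpha^{\,i}_j\bigl(\hat d_{\mathrm{TLA}}\,\omega^j_{\mathrm{loc}}\bigr)$; 3. for all $i,j$ the map $\hat\alpha^{\,i}_j:\Omega^\bullet_{\mathrm{TLA}}(U_{ij},\mathfrak g)\to\Omega^\bullet_{\mathrm{TLA}}(U_{ij},\mathfrak g)$ is an isomorphism of graded differential Lie algebras: it is linear and bijective in each degree, preserves the graded Lie bracket and commutes with $\hat d_{\mathrm{TLA}}$. -/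

import Mathlib

open scoped TensorProduct Manifold ContDiff Topology
open TopologicalSpace Filter

namespace LieAlgd

noncomputable section

set_option linter.unusedSectionVars false

/-! ### The Koszul differential -/

/-- The data that enter the Koszul formula for forms on the `R`-module `A` with values in the
`R`-module `W`: an anchor, a skew bracket on `A` and an action of `A` on `W`, with the Leibniz rules
that make the Koszul formula `R`-multilinear. -/
structure KoszulDatum (𝕜 R A W : Type*) [Field 𝕜] [CommRing R] [Algebra 𝕜 R]
    [AddCommGroup A] [Module 𝕜 A] [Module R A]
    [AddCommGroup W] [Module 𝕜 W] [Module R W] where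
  anchor : A → Derivation 𝕜 R R
  br : A →ₗ[𝕜] A →ₗ[𝕜] A
  act : A →ₗ[𝕜] W →ₗ[𝕜] W
  br_self : ∀ X, br X X = 0
  br_smul : ∀ (X Y : A) (f : R), br X (f • Y) = f • br X Y + anchor X f • Y
  act_smul_left : ∀ (f : R) (X : A) (w : W), act (f • X) w = f • act X w
  act_smul : ∀ (X : A) (f : R) (w : W), act X (f • w) = f • act X w + anchor X f • w

namespace KoszulDatum

variable {𝕜 R A W : Type*} [Field 𝕜] [CommRing R] [Algebra 𝕜 R]
    [AddCommGroup A] [Module 𝕜 A] [Module R A] [IsScalarTower 𝕜 R A]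
    [AddCommGroup W] [Module 𝕜 W] [Module R W] [IsScalarTower 𝕜 R W]
    (K : KoszulDatum 𝕜 R A W)

lemma br_swap (X Y : A) : K.br X Y = - K.br Y X := by
  have h := K.br_self (X + Y)
  simp only [map_add, LinearMap.add_apply, K.br_self, zero_add, add_zero] at h
  exact eq_neg_of_add_eq_zero_right h

lemma smul_br (X Y : A) (f : R) : K.br (f • X) Y = f • K.br X Y - K.anchor Y f • X := by
  rw [K.br_swap, K.br_smul, K.br_swap Y X]
  simp [neg_add_rev, sub_eq_add_neg, add_comm]

/-- `θ` regarded as an alternating map over `𝕜`. -/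
def overField {q : ℕ} (θ : A [⋀^Fin q]→ₗ[R] W) : A [⋀^Fin q]→ₗ[𝕜] W :=
  { θ.toMultilinearMap.restrictScalars 𝕜 with
    map_eq_zero_of_eq' := fun v _ _ h hij => θ.map_eq_zero_of_eq v h hij }

@[simp] lemma overField_apply {q : ℕ} (θ : A [⋀^Fin q]→ₗ[R] W) (v : Fin q → A) :
    overField (𝕜 := 𝕜) θ v = θ v := rfl

/-- `X ↦ ((Y₁, …, Y_q) ↦ X · θ(Y₁, …, Y_q))`. -/
def actForm {q : ℕ} (θ : A [⋀^Fin q]→ₗ[R] W) : A →ₗ[𝕜] A [⋀^Fin q]→ₗ[𝕜] W where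
  toFun X := (K.act X).compAlternatingMap (overField θ)
  map_add' X Y := by ext; simp
  map_smul' c X := by ext; simp

/-- `X ↦ ((Y₁, …, Y_q) ↦ ∑ₖ θ(Y₁, …, [X, Yₖ], …, Y_q))`. -/
def brForm {q : ℕ} (θ : A [⋀^Fin q]→ₗ[R] W) : A →ₗ[𝕜] A [⋀^Fin q]→ₗ[𝕜] W where
  toFun X :=
    { toFun := fun Y => ∑ k, θ (Function.update Y k (K.br X (Y k)))
      map_update_add' := fun {hd} Y i a b => by
        cases Subsingleton.elim hd (instDecidableEqFin q)
        rw [← Finset.sum_add_distrib]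
        refine Finset.sum_congr rfl fun k _ => ?_
        by_cases hk : k = i
        · subst hk; simp
        · simp only [Function.update_of_ne hk, Function.update_comm (Ne.symm hk), θ.map_update_add]
      map_update_smul' := fun {hd} Y i c a => by
        cases Subsingleton.elim hd (instDecidableEqFin q)
        rw [Finset.smul_sum]
        refine Finset.sum_congr rfl fun k _ => ?_
        by_cases hk : k = i
        · subst hk
          simp only [Function.update_self, Function.update_idem, map_smul]
          exact (overField (𝕜 := 𝕜) θ).map_update_smul Y k c (K.br X a)
        · simpa only [Function.update_of_ne hk, Function.update_comm (Ne.symm hk),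
            overField_apply] using (overField (𝕜 := 𝕜) θ).map_update_smul
              (Function.update Y k (K.br X (Y k))) i c a
      map_eq_zero_of_eq' := fun Y i j h hij => by
        rw [Fintype.sum_eq_add i j hij]
        · have e : Function.update Y j (K.br X (Y j))
              = Function.update Y i (K.br X (Y i)) ∘ Equiv.swap i j := by
            funext k
            by_cases hi : k = i
            · subst hi; simp [hij, h, Ne.symm hij]
            by_cases hj : k = j
            · subst hj; simp [h]
            · simp [Equiv.swap_apply_of_ne_of_ne hi hj, hi, hj]
          rw [e, θ.map_swap _ hij, add_neg_cancel]
        · rintro k ⟨hki, hkj⟩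
          exact θ.map_eq_zero_of_eq _ (by simp [Ne.symm hki, Ne.symm hkj, h]) hij }
  map_add' X Y := by ext; simp [Finset.sum_add_distrib]
  map_smul' c X := by
    ext v
    simp only [AlternatingMap.coe_mk, MultilinearMap.coe_mk, AlternatingMap.smul_apply,
      RingHom.id_apply, Finset.smul_sum, map_smul, LinearMap.smul_apply]
    exact Finset.sum_congr rfl fun k _ => (overField (𝕜 := 𝕜) θ).map_update_smul v k c _

/-- The Koszul formula, as an alternating map over `𝕜`. -/
def dField {q : ℕ} (θ : A [⋀^Fin q]→ₗ[R] W) : A [⋀^Fin (q + 1)]→ₗ[𝕜] W :=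
  AlternatingMap.alternatizeUncurryFin (K.actForm θ)
    - (2⁻¹ : 𝕜) • AlternatingMap.alternatizeUncurryFin (K.brForm θ)

/-- The first sum of the Koszul formula. -/
def actSum {q : ℕ} (θ : A [⋀^Fin q]→ₗ[R] W) (X : Fin (q + 1) → A) : W :=
  ∑ i : Fin (q + 1), (-1) ^ (i : ℕ) • K.act (X i) (θ (i.removeNth X))

/-- Twice the second sum of the Koszul formula. -/
def brSum {q : ℕ} (θ : A [⋀^Fin q]→ₗ[R] W) (X : Fin (q + 1) → A) : W :=
  ∑ i : Fin (q + 1), (-1) ^ (i : ℕ) •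
        ∑ k, θ (Function.update (i.removeNth X) k (K.br (X i) (i.removeNth X k)))

lemma dField_apply {q : ℕ} (θ : A [⋀^Fin q]→ₗ[R] W) (X : Fin (q + 1) → A) :
    K.dField θ X = K.actSum θ X - (2⁻¹ : 𝕜) • K.brSum θ X := by
  simp [dField, AlternatingMap.alternatizeUncurryFin_apply, actForm, brForm, actSum, brSum]

lemma removeNth_succ_cons {m : ℕ} {B : Type*} (j : Fin (m + 1)) (x : B) (Y : Fin (m + 1) → B) :
    j.succ.removeNth (Fin.cons x Y : Fin (m + 2) → B) = Fin.cons x (j.removeNth Y) := by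
  funext k
  refine Fin.cases ?_ (fun l => ?_) k <;> simp [Fin.removeNth]

lemma map_cons_smul {m : ℕ} (θ : A [⋀^Fin (m + 1)]→ₗ[R] W) (f : R) (x : A) (Z : Fin m → A) :
    θ (Fin.cons (f • x) Z) = f • θ (Fin.cons x Z) :=
  θ.toMultilinearMap.cons_smul Z f x

lemma map_cons_add {m : ℕ} (θ : A [⋀^Fin (m + 1)]→ₗ[R] W) (x y : A) (Z : Fin m → A) :
    θ (Fin.cons (x + y) Z) = θ (Fin.cons x Z) + θ (Fin.cons y Z) :=
  θ.toMultilinearMap.cons_add Z x y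

lemma map_update_eq {m : ℕ} (θ : A [⋀^Fin (m + 1)]→ₗ[R] W) (k : Fin (m + 1)) (x : A)
    (Y : Fin (m + 1) → A) :
    θ (Function.update Y k x) = (-1) ^ (k : ℕ) • θ (Fin.cons x (k.removeNth Y)) := by
  rw [← Fin.insertNth_removeNth]
  exact θ.map_insertNth k x (k.removeNth Y)

lemma actSum_smul {m : ℕ} (θ : A [⋀^Fin (m + 1)]→ₗ[R] W) (f : R) (x : A) (Y : Fin (m + 1) → A) :
    K.actSum θ (Fin.cons (f • x) Y) = f • K.actSum θ (Fin.cons x Y)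
      - ∑ j : Fin (m + 1), (-1) ^ (j : ℕ) • K.anchor (Y j) f • θ (Fin.cons x (j.removeNth Y)) := by
  simp only [actSum, Fin.sum_univ_succ (n := m + 1), Fin.cons_zero, Fin.cons_succ,
    Fin.removeNth_zero, Fin.tail_cons, removeNth_succ_cons, map_cons_smul, K.act_smul,
    K.act_smul_left, Fin.val_succ, pow_succ, smul_add, Finset.sum_add_distrib, Finset.smul_sum,
    mul_neg, mul_one, neg_smul, Finset.sum_neg_distrib, smul_neg, smul_comm f]
  abel

lemma brSum_smul {m : ℕ} (θ : A [⋀^Fin (m + 1)]→ₗ[R] W) (f : R) (x : A) (Y : Fin (m + 1) → A) :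
    K.brSum θ (Fin.cons (f • x) Y) = f • K.brSum θ (Fin.cons x Y)
      - (2 : 𝕜) • ∑ j : Fin (m + 1), (-1) ^ (j : ℕ) •
        K.anchor (Y j) f • θ (Fin.cons x (j.removeNth Y)) := by
  have h0 : ∑ k, θ (Function.update Y k (K.br (f • x) (Y k)))
      = f • (∑ k, θ (Function.update Y k (K.br x (Y k))))
        - ∑ k : Fin (m + 1), (-1) ^ (k : ℕ) •
          K.anchor (Y k) f • θ (Fin.cons x (k.removeNth Y)) := by
    rw [Finset.smul_sum, ← Finset.sum_sub_distrib]
    refine Finset.sum_congr rfl fun k _ => ?_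
    rw [K.smul_br, θ.map_update_sub, θ.map_update_smul, θ.map_update_smul, map_update_eq θ k x,
      smul_comm (K.anchor (Y k) f)]
  have h1 : ∀ j : Fin (m + 1),
      ∑ k, θ (Function.update (Fin.cons (f • x) (j.removeNth Y) : Fin (m + 1) → A) k
        (K.br (Y j) ((Fin.cons (f • x) (j.removeNth Y) : Fin (m + 1) → A) k)))
      = f • (∑ k, θ (Function.update (Fin.cons x (j.removeNth Y) : Fin (m + 1) → A) k
        (K.br (Y j) ((Fin.cons x (j.removeNth Y) : Fin (m + 1) → A) k))))
        + K.anchor (Y j) f • θ (Fin.cons x (j.removeNth Y)) := by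
    intro j
    simp only [Fin.sum_univ_succ (n := m), Fin.cons_zero, Fin.cons_succ, Fin.update_cons_zero,
      ← Fin.cons_update, map_cons_add, map_cons_smul, K.br_smul, smul_add, Finset.smul_sum]
    abel
  simp only [brSum, Fin.sum_univ_succ (n := m + 1), Fin.cons_zero, Fin.cons_succ,
    Fin.removeNth_zero, Fin.tail_cons, removeNth_succ_cons, h0, h1]
  simp only [Fin.val_succ, pow_succ, Fin.val_zero, pow_zero, one_smul, mul_neg, mul_one, neg_smul,
    Finset.sum_neg_distrib, smul_add, Finset.sum_add_distrib, Finset.smul_sum, smul_neg, two_smul,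
    smul_comm f]
  abel

lemma dField_smul_zero [CharZero 𝕜] {q : ℕ} (θ : A [⋀^Fin q]→ₗ[R] W) (f : R) (x : A)
    (Y : Fin q → A) :
    K.dField θ (Fin.cons (f • x) Y) = f • K.dField θ (Fin.cons x Y) := by
  rw [dField_apply, dField_apply]
  cases q with
  | zero =>
    simp [actSum, brSum, K.act_smul_left]
  | succ m =>
    rw [actSum_smul, brSum_smul, smul_sub (2⁻¹ : 𝕜), smul_smul (2⁻¹ : 𝕜),
      inv_mul_cancel₀ two_ne_zero, one_smul, smul_sub f, smul_comm f (2⁻¹ : 𝕜)]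
    abel

lemma dField_smul [CharZero 𝕜] {q : ℕ} (θ : A [⋀^Fin q]→ₗ[R] W) (X : Fin (q + 1) → A)
    (i : Fin (q + 1)) (f : R) (x : A) :
    K.dField θ (Function.update X i (f • x)) = f • K.dField θ (Function.update X i x) := by
  rw [← Fin.insertNth_removeNth, ← Fin.insertNth_removeNth]
  erw [AlternatingMap.map_insertNth, AlternatingMap.map_insertNth, K.dField_smul_zero, smul_comm f]
  rfl

/-- The Koszul differential
`(dθ)(X₀, …, X_q) = ∑ᵢ (-1)ⁱ Xᵢ · θ(…, X̂ᵢ, …) + ∑_{i<j} (-1)^{i+j} θ([Xᵢ, Xⱼ], …, X̂ᵢ, …, X̂ⱼ, …)`.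
In the second sum, `[Xᵢ, Xⱼ]` is moved to the place of `Xⱼ`; the sum then runs over all ordered
pairs `i ≠ j`, so that each unordered pair occurs twice, whence the factor `1/2` (and the sign). -/
def d [CharZero 𝕜] {q : ℕ} (θ : A [⋀^Fin q]→ₗ[R] W) : A [⋀^Fin (q + 1)]→ₗ[R] W where
  toFun X := ∑ i : Fin (q + 1), (-1) ^ (i : ℕ) • K.act (X i) (θ (i.removeNth X))
    - (2⁻¹ : 𝕜) • ∑ i : Fin (q + 1), (-1) ^ (i : ℕ) •
        ∑ k, θ (Function.update (i.removeNth X) k (K.br (X i) (i.removeNth X k)))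
  map_update_add' {hd} X i x y := by
    cases Subsingleton.elim hd (instDecidableEqFin (q + 1))
    simpa only [dField_apply, actSum, brSum] using (K.dField θ).map_update_add X i x y
  map_update_smul' {hd} X i f x := by
    cases Subsingleton.elim hd (instDecidableEqFin (q + 1))
    simpa only [dField_apply, actSum, brSum] using K.dField_smul θ X i f x
  map_eq_zero_of_eq' X i j h hij := by
    simpa only [dField_apply, actSum, brSum] using (K.dField θ).map_eq_zero_of_eq X h hij


end KoszulDatum

/-! ### Forms on a Lie algebroid with values in its kernel

A Lie algebroid is a Lie-Rinehart algebra `A` over `R = C^∞(M)` (which is finitely generated and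
projective as a module); `⁅X, f⁆` is the derivative of `f` along the anchor of `X`. -/

section forms

variable (𝕜 R A : Type*) [Field 𝕜] [CommRing R] [Algebra 𝕜 R]
  [LieRing A] [LieAlgebra 𝕜 A] [Module R A] [LieRingModule A R] [LieRinehartRing R A]
  [LieRinehartAlgebra 𝕜 R A]

/-- The kernel `L` of the anchor. -/
def kernel : Submodule R A where
  carrier := {X | LieRinehartAlgebra.anchor 𝕜 R A X = 0}
  add_mem' {X Y} hX hY := by
    have hX' : LieRinehartAlgebra.anchor 𝕜 R A X = 0 := hX
    have hY' : LieRinehartAlgebra.anchor 𝕜 R A Y = 0 := hY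
    simp [hX', hY']
  zero_mem' := by simp
  smul_mem' f X hX := by
    have hX' : LieRinehartAlgebra.anchor 𝕜 R A X = 0 := hX
    have := (LieRinehartAlgebra.anchor 𝕜 R A).map_smul_apply f X
    simp only [hX', smul_zero] at this
    exact this

variable {𝕜 R A}

lemma mem_kernel {X : A} : X ∈ kernel 𝕜 R A ↔ ∀ f : R, ⁅X, f⁆ = 0 := by
  constructor
  · intro h f
    have h' : LieRinehartAlgebra.anchor 𝕜 R A X = 0 := h
    rw [← LieRinehartAlgebra.anchor_apply (R := 𝕜), h']
    rfl
  · intro h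
    change LieRinehartAlgebra.anchor 𝕜 R A X = 0
    ext f
    exact h f

lemma lie_mem_kernel (X : A) {ℓ : A} (h : ℓ ∈ kernel 𝕜 R A) : ⁅X, ℓ⁆ ∈ kernel 𝕜 R A := by
  rw [mem_kernel] at h ⊢
  intro f
  rw [lie_lie, h, h, lie_zero, sub_zero]

variable (𝕜 R A) in
/-- The adjoint representation `X · ℓ = [X, ℓ]` of `A` on its kernel. -/
def adjointDatum : KoszulDatum 𝕜 R A (kernel 𝕜 R A) where
  anchor X := LieRinehartAlgebra.anchor 𝕜 R A X
  br := LinearMap.mk₂ 𝕜 (fun X Y => ⁅X, Y⁆) add_lie smul_lie lie_add (fun c X Y => lie_smul c X Y)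
  act := LinearMap.mk₂ 𝕜 (fun X ℓ => ⟨⁅X, (ℓ : A)⁆, lie_mem_kernel X ℓ.2⟩)
    (fun _ _ _ => Subtype.ext (add_lie _ _ _)) (fun _ _ _ => Subtype.ext (smul_lie _ _ _))
    (fun _ _ _ => Subtype.ext (lie_add _ _ _)) (fun _ _ _ => Subtype.ext (lie_smul _ _ _))
  br_self X := lie_self X
  br_smul X Y f := LieRinehartRing.leibniz_smul_right X Y f
  act_smul_left f X ℓ := Subtype.ext <| by
    change ⁅f • X, (ℓ : A)⁆ = f • ⁅X, (ℓ : A)⁆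
    rw [← lie_skew, LieRinehartRing.leibniz_smul_right, mem_kernel.1 ℓ.2, zero_smul, add_zero,
      ← smul_neg, lie_skew]
  act_smul X f ℓ := Subtype.ext (LieRinehartRing.leibniz_smul_right X (ℓ : A) f)

variable (𝕜 R A) in
/-- `Ω^q(A, L)`: the `R`-multilinear alternating maps `A^q → L`, where `L` is the kernel of `A`. -/
abbrev KForm (q : ℕ) := A [⋀^Fin q]→ₗ[R] kernel 𝕜 R A

/-- The differential `d̂` of `Ω^•(A, L)`, for the adjoint representation of `A` on `L`. -/
def dHat [CharZero 𝕜] {q : ℕ} (θ : KForm 𝕜 R A q) : KForm 𝕜 R A (q + 1) :=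
  (adjointDatum 𝕜 R A).d θ

end forms

/-! ### The trivial Lie algebroid and its forms -/

section trivial

variable (𝕜 R g : Type*) [Field 𝕜] [CommRing R] [Algebra 𝕜 R] [LieRing g] [LieAlgebra 𝕜 g]

/-- The trivial Lie algebroid `TLA(U, g) = Γ(TU) ⊕ Γ(U × g)`, with `R = C^∞(U)`, `Γ(TU)` the
derivations of `R` and `Γ(U × g) = R ⊗ g`. -/
abbrev TLA := Derivation 𝕜 R R × (R ⊗[𝕜] g)

variable {𝕜 R} in
/-- The derivative `X · γ` of a `g`-valued function `γ ∈ R ⊗ g` along the vector field `X`. -/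
def derAct (X : Derivation 𝕜 R R) : R ⊗[𝕜] g →ₗ[𝕜] R ⊗[𝕜] g :=
  LinearMap.rTensor g (X : R →ₗ[𝕜] R)

variable {𝕜 R g}

@[simp] lemma derAct_tmul (X : Derivation 𝕜 R R) (f : R) (v : g) :
    derAct g X (f ⊗ₜ v) = X f ⊗ₜ v := rfl

lemma derAct_add_left (X Y : Derivation 𝕜 R R) (γ : R ⊗[𝕜] g) :
    derAct g (X + Y) γ = derAct g X γ + derAct g Y γ := by
  induction γ with
  | zero => simp
  | tmul f v => simp [TensorProduct.add_tmul]
  | add γ η h1 h2 => simp only [map_add, h1, h2]; abel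

lemma derAct_smul_left (c : 𝕜) (X : Derivation 𝕜 R R) (γ : R ⊗[𝕜] g) :
    derAct g (c • X) γ = c • derAct g X γ := by
  induction γ with
  | zero => simp
  | tmul f v => simp [TensorProduct.smul_tmul']
  | add γ η h1 h2 => simp only [map_add, h1, h2, smul_add]

lemma derAct_fsmul_left (f : R) (X : Derivation 𝕜 R R) (γ : R ⊗[𝕜] g) :
    derAct g (f • X) γ = f • derAct g X γ := by
  induction γ with
  | zero => simp
  | tmul f v => simp [TensorProduct.smul_tmul']
  | add γ η h1 h2 => simp only [map_add, h1, h2, smul_add]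

lemma derAct_fsmul (f : R) (X : Derivation 𝕜 R R) (γ : R ⊗[𝕜] g) :
    derAct g X (f • γ) = f • derAct g X γ + X f • γ := by
  induction γ with
  | zero => simp
  | tmul h v => simp [TensorProduct.smul_tmul', TensorProduct.add_tmul, mul_comm h]
  | add γ η h1 h2 => simp only [map_add, h1, h2, smul_add]; abel

variable (𝕜 R g) in
/-- The part of the structure of `TLA` that does not involve the bracket of `g`: the anchor
`X ⊕ γ ↦ X`, the bracket `[X, Y] ⊕ (X · η - Y · γ)` and the action `X · η` of `X ⊕ γ` on `η`. Its
Koszul differential is the de Rham differential on `Ω^•(U) ⊗ Λ^• g* ⊗ g`. -/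
def deRhamDatum : KoszulDatum 𝕜 R (TLA 𝕜 R g) (R ⊗[𝕜] g) where
  anchor X := X.1
  br := LinearMap.mk₂ 𝕜 (fun X Y => (⁅X.1, Y.1⁆, derAct g X.1 Y.2 - derAct g Y.1 X.2))
    (fun X Y Z => by ext1 <;> simp [derAct_add_left]; abel)
    (fun c X Y => by ext1 <;> simp [derAct_smul_left, smul_sub])
    (fun X Y Z => by ext1 <;> simp [derAct_add_left]; abel)
    (fun c X Y => by ext1 <;> simp [derAct_smul_left, smul_sub])
  act := LinearMap.mk₂ 𝕜 (fun X η => derAct g X.1 η)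
    (fun X Y η => by simp [derAct_add_left]) (fun c X η => by simp [derAct_smul_left])
    (fun X η θ => by simp) (fun c X η => by simp)
  br_self X := by simp
  br_smul X Y f := by
    ext1
    · simp
    · simp [derAct_fsmul, derAct_fsmul_left, smul_sub]; abel
  act_smul_left f X w := by simp [derAct_fsmul_left]
  act_smul X f w := by simp [derAct_fsmul]

variable (𝕜 R g) in
/-- The part of the structure of `TLA` that comes from the bracket of `g`: the bracket
`0 ⊕ [γ, η]` and the adjoint action `[γ, η]` of `X ⊕ γ` on `η`. Its Koszul differential is the
Chevalley-Eilenberg differential on `Ω^•(U) ⊗ Λ^• g* ⊗ g` for the adjoint representation. -/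
def chevalleyEilenbergDatum : KoszulDatum 𝕜 R (TLA 𝕜 R g) (R ⊗[𝕜] g) where
  anchor _ := 0
  br := LinearMap.mk₂ 𝕜 (fun X Y => (0, ⁅X.2, Y.2⁆))
    (fun X Y Z => by ext1 <;> simp) (fun c X Y => by ext1 <;> simp)
    (fun X Y Z => by ext1 <;> simp) (fun c X Y => by ext1 <;> simp)
  act := LinearMap.mk₂ 𝕜 (fun X η => ⁅X.2, η⁆)
    (fun X Y η => by simp) (fun c X η => by simp)
    (fun X η θ => by simp) (fun c X η => by simp)
  br_self X := by simp
  br_smul X Y f := by ext1 <;> simp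
  act_smul_left f X w := by simp
  act_smul X f w := by simp

variable (𝕜 R g) in
/-- `Ω^q_TLA(U, g)`: the `C^∞(U)`-multilinear alternating maps `TLA(U, g)^q → Γ(U × g)`, i.e. the
part of total degree `q` of `Ω^•(U) ⊗ Λ^• g* ⊗ g`. -/
abbrev TLAForm (q : ℕ) := TLA 𝕜 R g [⋀^Fin q]→ₗ[R] R ⊗[𝕜] g

/-- The de Rham differential `d` on `Ω^•_TLA(U, g)`. -/
def dDeRham [CharZero 𝕜] {q : ℕ} (θ : TLAForm 𝕜 R g q) :
    TLAForm 𝕜 R g (q + 1) :=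
  (deRhamDatum 𝕜 R g).d θ

/-- The Chevalley-Eilenberg differential `s'` on `Ω^•_TLA(U, g)`. -/
def sPrime [CharZero 𝕜] {q : ℕ} (θ : TLAForm 𝕜 R g q) :
    TLAForm 𝕜 R g (q + 1) :=
  (chevalleyEilenbergDatum 𝕜 R g).d θ

/-- The differential `d_TLA = d + s'` of `Ω^•_TLA(U, g)`. The two brackets above add up to
`[X ⊕ γ, Y ⊕ η] = [X, Y] ⊕ (X · η - Y · γ + [γ, η])`. -/
def dTLA [CharZero 𝕜] {q : ℕ} (θ : TLAForm 𝕜 R g q) :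
    TLAForm 𝕜 R g (q + 1) :=
  dDeRham θ + sPrime θ

/-- The graded Lie bracket `[θ, η](Y₁, …) = ∑ sgn(σ) [θ(Y_{σ(1)}, …), η(Y_{σ(p+1)}, …)]` of
`Ω^•_TLA(U, g)`; the sum runs over the `(p, q)`-shuffles `σ`. -/
def formBracket {p q : ℕ} (θ : TLAForm 𝕜 R g p) (η : TLAForm 𝕜 R g q) :
    TLAForm 𝕜 R g (p + q) :=
  ((TensorProduct.lift (LinearMap.mk₂ R (fun γ δ : R ⊗[𝕜] g => ⁅γ, δ⁆) add_lie smul_lie lie_add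
      fun f γ δ => lie_smul f γ δ)).compAlternatingMap
    (θ.domCoprod η)).domDomCongr finSumFinEquiv

variable (𝕜 R g) in
/-- The family `φ` of maps is an isomorphism of the graded differential Lie algebra
`Ω^•_TLA(U, g)` onto itself. -/
structure IsGradedDiffLieIso [CharZero 𝕜]
    (φ : ∀ q : ℕ, TLAForm 𝕜 R g q →ₗ[R] TLAForm 𝕜 R g q) : Prop where
  bijective : ∀ q, Function.Bijective (φ q)
  map_bracket : ∀ (p q : ℕ) (θ : TLAForm 𝕜 R g p) (η : TLAForm 𝕜 R g q),
    φ (p + q) (formBracket θ η) = formBracket (φ p θ) (φ q η)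
  map_d : ∀ (q : ℕ) (θ : TLAForm 𝕜 R g q), φ (q + 1) (dTLA θ) = dTLA (φ q θ)

end trivial

/-! ### Smooth functions and vector fields on a manifold and on its open subsets -/

/-- The algebra of smooth `𝕜`-valued functions on the manifold `N`, where `𝕜` is `ℝ` or `ℂ`. -/
def smoothFun (𝕜 E N : Type*) [RCLike 𝕜] [NormedAddCommGroup E] [NormedSpace ℝ E]
    [TopologicalSpace N] [ChartedSpace E N] : Subalgebra 𝕜 (N → 𝕜) where
  carrier := {f | ContMDiff 𝓘(ℝ, E) 𝓘(ℝ, 𝕜) ∞ f}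
  mul_mem' {f g} hf hg := by
    have : ContDiff ℝ ∞ (fun p : 𝕜 × 𝕜 => p.1 * p.2) := contDiff_mul
    exact this.contMDiff.comp (hf.prodMk_space hg)
  add_mem' {f g} hf hg := ContMDiff.add hf hg
  algebraMap_mem' c := contMDiff_const

/-- `C^∞(N)`, with values in `𝕜`. -/
def SmoothFun (𝕜 E N : Type*) [RCLike 𝕜] [NormedAddCommGroup E] [NormedSpace ℝ E]
    [TopologicalSpace N] [ChartedSpace E N] : Type _ := ↥(smoothFun 𝕜 E N)

namespace SmoothFun
variable {𝕜 E N : Type*} [RCLike 𝕜] [NormedAddCommGroup E] [NormedSpace ℝ E]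
    [TopologicalSpace N] [ChartedSpace E N]

instance : CommRing (SmoothFun 𝕜 E N) := inferInstanceAs (CommRing ↥(smoothFun 𝕜 E N))
instance : Algebra 𝕜 (SmoothFun 𝕜 E N) := inferInstanceAs (Algebra 𝕜 ↥(smoothFun 𝕜 E N))
instance : FunLike (SmoothFun 𝕜 E N) N 𝕜 where
  coe f := f.1
  coe_injective _ _ h := Subtype.ext h

/-- Bundle a smooth function. -/
def mk (f : N → 𝕜) (hf : ContMDiff 𝓘(ℝ, E) 𝓘(ℝ, 𝕜) ∞ f) : SmoothFun 𝕜 E N := ⟨f, hf⟩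

protected lemma contMDiff (f : SmoothFun 𝕜 E N) : ContMDiff 𝓘(ℝ, E) 𝓘(ℝ, 𝕜) ∞ f := f.2

@[simp] lemma mk_apply (f : N → 𝕜) (hf : ContMDiff 𝓘(ℝ, E) 𝓘(ℝ, 𝕜) ∞ f) (x : N) :
    (mk f hf : SmoothFun 𝕜 E N) x = f x := rfl

@[ext] lemma ext {f g : SmoothFun 𝕜 E N} (h : ∀ x, f x = g x) : f = g := DFunLike.ext f g h
@[simp] lemma add_apply (f g : SmoothFun 𝕜 E N) (x : N) : (f + g) x = f x + g x := rfl
@[simp] lemma sub_apply (f g : SmoothFun 𝕜 E N) (x : N) : (f - g) x = f x - g x := rfl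
@[simp] lemma neg_apply (f : SmoothFun 𝕜 E N) (x : N) : (-f) x = -f x := rfl
@[simp] lemma mul_apply (f g : SmoothFun 𝕜 E N) (x : N) : (f * g) x = f x * g x := rfl
@[simp] lemma zero_apply (x : N) : (0 : SmoothFun 𝕜 E N) x = 0 := rfl
@[simp] lemma one_apply (x : N) : (1 : SmoothFun 𝕜 E N) x = 1 := rfl
@[simp] lemma smul_apply (c : 𝕜) (f : SmoothFun 𝕜 E N) (x : N) : (c • f) x = c * f x := rfl
@[simp] lemma algebraMap_apply (c : 𝕜) (x : N) : algebraMap 𝕜 (SmoothFun 𝕜 E N) c x = c := rfl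
end SmoothFun

section basic
variable {𝕜 E N : Type*} [RCLike 𝕜] [NormedAddCommGroup E] [NormedSpace ℝ E]
    [TopologicalSpace N] [ChartedSpace E N] 

/-- The restriction of functions to an open subset. -/
def SmoothFun.restrict (V : Opens N) : SmoothFun 𝕜 E N →ₐ[𝕜] SmoothFun 𝕜 E V where
  toFun f := mk (fun x => f x) (f.contMDiff.comp contMDiff_subtype_val)
  map_one' := rfl
  map_mul' _ _ := rfl
  map_zero' := rfl
  map_add' _ _ := rfl
  commutes' _ := rfl

/-- The restriction of functions from an open subset to a smaller one. -/
def SmoothFun.res {V U : Opens N} (h : V ≤ U) : SmoothFun 𝕜 E U →ₐ[𝕜] SmoothFun 𝕜 E V where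
  toFun f := mk (fun x => f ⟨x, h x.2⟩) (f.contMDiff.comp (contMDiff_inclusion h))
  map_one' := rfl
  map_mul' _ _ := rfl
  map_zero' := rfl
  map_add' _ _ := rfl
  commutes' _ := rfl

variable [FiniteDimensional ℝ E] [IsManifold 𝓘(ℝ, E) ∞ N] [T2Space N]

lemma exists_bump (x : N) {W : Set N} (hW : W ∈ 𝓝 x) :
    ∃ φ : SmoothFun 𝕜 E N, (∀ᶠ y in 𝓝 x, φ y = 1) ∧ tsupport φ ⊆ W := by
  obtain ⟨f, -, hf⟩ := (SmoothBumpFunction.nhds_basis_tsupport (I := 𝓘(ℝ, E)) x).mem_iff.1 hW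
  have hc : ContDiff ℝ ∞ (fun r : ℝ => (r : 𝕜)) := (RCLike.ofRealCLM (K := 𝕜)).contDiff
  refine ⟨SmoothFun.mk (fun y => ((f y : ℝ) : 𝕜)) (hc.contMDiff.comp f.contMDiff), ?_, ?_⟩
  · filter_upwards [f.eventuallyEq_one] with y hy
    simp [hy]
  · refine (closure_mono ?_).trans hf
    intro y hy
    simp only [Function.mem_support, SmoothFun.mk_apply, ne_eq, RCLike.ofReal_eq_zero] at hy ⊢
    exact hy

lemma smoothFun_of_local {f : N → 𝕜}
    (h : ∀ x, ∃ g : SmoothFun 𝕜 E N, ∀ᶠ y in 𝓝 x, f y = g y) : ContMDiff 𝓘(ℝ, E) 𝓘(ℝ, 𝕜) ∞ f := by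
  intro x
  obtain ⟨g, hg⟩ := h x
  exact g.contMDiff.contMDiffAt.congr_of_eventuallyEq hg

open Classical in
/-- The product `φ f`, extended by zero outside `V`. -/
def zeroExt (V : Opens N) (φ : SmoothFun 𝕜 E N) (hφ : tsupport φ ⊆ V) (f : SmoothFun 𝕜 E V) :
    SmoothFun 𝕜 E N :=
  SmoothFun.mk (fun y => φ y * (if h : y ∈ V then f ⟨y, h⟩ else 0)) <| by
    let f' : N → 𝕜 := fun y => if h : y ∈ V then f ⟨y, h⟩ else 0
    have hf' : ∀ y : V, f' y = f y := fun y => by simp [f', y.2]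
    change ContMDiff 𝓘(ℝ, E) 𝓘(ℝ, 𝕜) ∞ (fun y => φ y * f' y)
    intro y
    by_cases hy : y ∈ V
    · have h3 : ContMDiffAt 𝓘(ℝ, E) 𝓘(ℝ, 𝕜) ∞ f' y := by
        have := (contMDiffAt_subtype_iff (I := 𝓘(ℝ, E)) (I' := 𝓘(ℝ, 𝕜)) (n := ∞) (f := f')
          (x := (⟨y, hy⟩ : V))).1
        apply this
        rw [show (fun x : V => f' x) = ⇑f from funext hf']
        exact f.contMDiff.contMDiffAt
      have : ContDiff ℝ ∞ (fun p : 𝕜 × 𝕜 => p.1 * p.2) := contDiff_mul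
      exact this.contMDiff.contMDiffAt.comp y (φ.contMDiff.contMDiffAt.prodMk_space h3)
    · have : (fun y => φ y * f' y) =ᶠ[𝓝 y] fun _ => 0 := by
        have : y ∉ tsupport φ := fun h => hy (hφ h)
        filter_upwards [(notMem_tsupport_iff_eventuallyEq (f := ⇑φ)).1 this] with z hz
        simp [hz]
      exact contMDiffAt_const.congr_of_eventuallyEq this

lemma zeroExt_apply (V : Opens N) (φ : SmoothFun 𝕜 E N) (hφ : tsupport φ ⊆ V)
    (f : SmoothFun 𝕜 E V) (y : V) : zeroExt V φ hφ f y = φ y * f y := by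
  simp only [zeroExt, SmoothFun.mk_apply, y.2, dif_pos]

lemma zeroExt_apply_of_notMem (V : Opens N) (φ : SmoothFun 𝕜 E N) (hφ : tsupport φ ⊆ V)
    (f : SmoothFun 𝕜 E V) {y : N} (hy : y ∉ V) : zeroExt V φ hφ f y = 0 := by
  simp only [zeroExt, SmoothFun.mk_apply, hy, dif_neg, not_false_eq_true, mul_zero]

/-- Every smooth function on an open set agrees near a given point with a global one. -/
lemma exists_ext (V : Opens N) (f : SmoothFun 𝕜 E V) (x : V) :
    ∃ F : SmoothFun 𝕜 E N, ∀ᶠ y in 𝓝 x, f y = F y := by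
  obtain ⟨φ, h1, h2⟩ := exists_bump (𝕜 := 𝕜) (E := E) (x : N) (V.isOpen.mem_nhds x.2)
  refine ⟨zeroExt V φ h2 f, ?_⟩
  filter_upwards [continuous_subtype_val.continuousAt.eventually h1] with y hy
  rw [zeroExt_apply, hy, one_mul]

lemma der_local (D : Derivation 𝕜 (SmoothFun 𝕜 E N) (SmoothFun 𝕜 E N)) (x : N)
    {f g : SmoothFun 𝕜 E N} (h : ∀ᶠ y in 𝓝 x, f y = g y) : D f x = D g x := by
  obtain ⟨φ, h1, h2⟩ := exists_bump (𝕜 := 𝕜) (E := E) x h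
  have h0 : φ * (f - g) = 0 := by
    ext y
    by_cases hy : f y = g y
    · change φ y * (f y - g y) = 0
      simp [hy]
    · have : φ y = 0 := image_eq_zero_of_notMem_tsupport (f := ⇑φ) fun hh => hy (h2 hh)
      change φ y * (f y - g y) = 0
      simp [this]
  have h3 := congrArg (fun u => (D u) x) h0
  simp only [Derivation.leibniz, map_sub, map_zero] at h3
  have h4 : φ x * (D f x - D g x) + (f x - g x) * (D φ) x = 0 := h3
  rw [h1.self_of_nhds, h.self_of_nhds] at h4
  simpa [sub_eq_zero] using h4

/-- The restriction of a vector field (a derivation of `C^∞(N)`) to an open set. -/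
def restrictDer (V : Opens N) (D : Derivation 𝕜 (SmoothFun 𝕜 E N) (SmoothFun 𝕜 E N)) :
    Derivation 𝕜 (SmoothFun 𝕜 E V) (SmoothFun 𝕜 E V) :=
  have key : ∀ (f : SmoothFun 𝕜 E V) (F : SmoothFun 𝕜 E N) (x : V), (∀ᶠ y in 𝓝 x, f y = F y) →
      D (exists_ext V f x).choose x = D F x := fun f F x h => by
    refine der_local D x ?_
    rw [← V.isOpen.isOpenEmbedding_subtypeVal.map_nhds_eq, eventually_map]
    filter_upwards [h, (exists_ext V f x).choose_spec] with y h1 h2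
    rw [← h1, ← h2]
  let T : SmoothFun 𝕜 E V → SmoothFun 𝕜 E V := fun f =>
    SmoothFun.mk (fun x => D (exists_ext V f x).choose x) <| smoothFun_of_local fun x =>
      ⟨SmoothFun.restrict V (D (exists_ext V f x).choose), by
        filter_upwards [eventually_eventually_nhds.2 (exists_ext V f x).choose_spec] with y hy
        exact key f _ y hy⟩
  have hT : ∀ (f : SmoothFun 𝕜 E V) (F : SmoothFun 𝕜 E N) (x : V), (∀ᶠ y in 𝓝 x, f y = F y) →
      T f x = D F x := key
  Derivation.mk'
    { toFun := T
      map_add' := fun f h => by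
        ext x
        obtain ⟨F, hF⟩ := exists_ext V f x
        obtain ⟨H, hH⟩ := exists_ext V h x
        rw [SmoothFun.add_apply, hT f F x hF, hT h H x hH, hT (f + h) (F + H) x, map_add,
          SmoothFun.add_apply]
        filter_upwards [hF, hH] with y h1 h2
        rw [SmoothFun.add_apply, SmoothFun.add_apply, h1, h2]
      map_smul' := fun c f => by
        ext x
        obtain ⟨F, hF⟩ := exists_ext V f x
        rw [RingHom.id_apply, SmoothFun.smul_apply, hT f F x hF, hT (c • f) (c • F) x, D.map_smul,
          SmoothFun.smul_apply]
        filter_upwards [hF] with y h1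
        rw [SmoothFun.smul_apply, SmoothFun.smul_apply, h1] }
    fun f h => by
      ext x
      obtain ⟨F, hF⟩ := exists_ext V f x
      obtain ⟨H, hH⟩ := exists_ext V h x
      have hFH : ∀ᶠ y in 𝓝 x, (f * h) y = (F * H : SmoothFun 𝕜 E N) y := by
        filter_upwards [hF, hH] with y h1 h2
        rw [SmoothFun.mul_apply, SmoothFun.mul_apply, h1, h2]
      change T (f * h) x = (f * T h + h * T f) x
      rw [hT (f * h) (F * H) x hFH, Derivation.leibniz]
      simp only [smul_eq_mul, SmoothFun.add_apply, SmoothFun.mul_apply]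
      rw [hT f F x hF, hT h H x hH, hF.self_of_nhds, hH.self_of_nhds]

lemma restrictDer_apply {V : Opens N} (D : Derivation 𝕜 (SmoothFun 𝕜 E N) (SmoothFun 𝕜 E N))
    {f : SmoothFun 𝕜 E V} {F : SmoothFun 𝕜 E N} {x : V} (h : ∀ᶠ y in 𝓝 x, f y = F y) :
    restrictDer V D f x = D F x := by
  change D (exists_ext V f x).choose x = D F x
  refine der_local D x ?_
  rw [← V.isOpen.isOpenEmbedding_subtypeVal.map_nhds_eq, eventually_map]
  filter_upwards [h, (exists_ext V f x).choose_spec] with y h1 h2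
  rw [← h1, ← h2]

lemma restrictDer_restrict {V : Opens N}
    (D : Derivation 𝕜 (SmoothFun 𝕜 E N) (SmoothFun 𝕜 E N)) (F : SmoothFun 𝕜 E N) :
    restrictDer V D (SmoothFun.restrict V F) = SmoothFun.restrict V (D F) := by
  ext x
  exact restrictDer_apply D (Eventually.of_forall fun _ => rfl)

lemma restrictDer_add {V : Opens N} (D D' : Derivation 𝕜 (SmoothFun 𝕜 E N) (SmoothFun 𝕜 E N)) :
    restrictDer V (D + D') = restrictDer V D + restrictDer V D' := by
  ext f x
  obtain ⟨F, hF⟩ := exists_ext V f x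
  simp only [Derivation.add_apply, SmoothFun.add_apply, restrictDer_apply _ hF]

lemma restrictDer_smul {V : Opens N} (φ : SmoothFun 𝕜 E N)
    (D : Derivation 𝕜 (SmoothFun 𝕜 E N) (SmoothFun 𝕜 E N)) :
    restrictDer V (φ • D) = SmoothFun.restrict V φ • restrictDer V D := by
  ext f x
  obtain ⟨F, hF⟩ := exists_ext V f x
  simp only [Derivation.smul_apply, smul_eq_mul, SmoothFun.mul_apply, restrictDer_apply _ hF]
  rfl

lemma restrictDer_lie {V : Opens N} (D D' : Derivation 𝕜 (SmoothFun 𝕜 E N) (SmoothFun 𝕜 E N)) :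
    restrictDer V ⁅D, D'⁆ = ⁅restrictDer V D, restrictDer V D'⁆ := by
  ext f x
  obtain ⟨F, hF⟩ := exists_ext V f x
  have h : ∀ D : Derivation 𝕜 (SmoothFun 𝕜 E N) (SmoothFun 𝕜 E N),
      ∀ᶠ y in 𝓝 x, restrictDer V D f y = D F y := fun D => by
    filter_upwards [eventually_eventually_nhds.2 hF] with y hy using restrictDer_apply D hy
  simp only [Derivation.commutator_apply, SmoothFun.sub_apply, restrictDer_apply _ hF,
    restrictDer_apply _ (h _)]

/-- The vector field `X` on `V` agrees near `x` with the global vector field `D`. -/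
def DerNear {V : Opens N} (X : Derivation 𝕜 (SmoothFun 𝕜 E V) (SmoothFun 𝕜 E V))
    (D : Derivation 𝕜 (SmoothFun 𝕜 E N) (SmoothFun 𝕜 E N)) (x : V) : Prop :=
  ∀ᶠ y in 𝓝 x, ∀ F, X (SmoothFun.restrict V F) y = D F y

lemma exists_derNear {V : Opens N} (X : Derivation 𝕜 (SmoothFun 𝕜 E V) (SmoothFun 𝕜 E V))
    (x : V) : ∃ D : Derivation 𝕜 (SmoothFun 𝕜 E N) (SmoothFun 𝕜 E N), DerNear X D x := by
  obtain ⟨φ, h1, h2⟩ := exists_bump (𝕜 := 𝕜) (E := E) (x : N) (V.isOpen.mem_nhds x.2)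
  refine ⟨Derivation.mk'
    { toFun := fun F => zeroExt V φ h2 (X (SmoothFun.restrict V F))
      map_add' := fun F G => ?_
      map_smul' := fun c F => ?_ } fun F G => ?_, ?_⟩
  · ext y
    by_cases hy : y ∈ V
    · lift y to V using hy
      simp only [SmoothFun.add_apply, zeroExt_apply, map_add, mul_add]
    · simp only [SmoothFun.add_apply, zeroExt_apply_of_notMem _ _ _ _ hy, add_zero]
  · ext y
    by_cases hy : y ∈ V
    · lift y to V using hy
      simp only [SmoothFun.smul_apply, zeroExt_apply, map_smul, X.map_smul, RingHom.id_apply]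
      ring
    · simp only [SmoothFun.smul_apply, zeroExt_apply_of_notMem _ _ _ _ hy, mul_zero,
        RingHom.id_apply]
  · ext y
    by_cases hy : y ∈ V
    · lift y to V using hy
      simp only [LinearMap.coe_mk, AddHom.coe_mk, SmoothFun.add_apply, smul_eq_mul,
        SmoothFun.mul_apply, zeroExt_apply, map_mul, Derivation.leibniz]
      have : ∀ H : SmoothFun 𝕜 E N, SmoothFun.restrict V H y = H y := fun _ => rfl
      rw [this, this]
      ring
    · simp only [LinearMap.coe_mk, AddHom.coe_mk, SmoothFun.add_apply, smul_eq_mul,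
        SmoothFun.mul_apply, zeroExt_apply_of_notMem _ _ _ _ hy, mul_zero, add_zero]
  · filter_upwards [continuous_subtype_val.continuousAt.eventually h1] with y hy F
    change _ = zeroExt V φ h2 (X (SmoothFun.restrict V F)) y
    rw [zeroExt_apply, hy, one_mul]

lemma DerNear.apply {V : Opens N} {X : Derivation 𝕜 (SmoothFun 𝕜 E V) (SmoothFun 𝕜 E V)}
    {D : Derivation 𝕜 (SmoothFun 𝕜 E N) (SmoothFun 𝕜 E N)} {x : V} (h : DerNear X D x)
    {f : SmoothFun 𝕜 E V} {F : SmoothFun 𝕜 E N} (hf : ∀ᶠ y in 𝓝 x, f y = F y) :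
    X f x = D F x := by
  rw [← h.self_of_nhds F]
  exact der_local X x hf

lemma DerNear.eventually {V : Opens N} {X : Derivation 𝕜 (SmoothFun 𝕜 E V) (SmoothFun 𝕜 E V)}
    {D : Derivation 𝕜 (SmoothFun 𝕜 E N) (SmoothFun 𝕜 E N)} {x : V} (h : DerNear X D x) :
    ∀ᶠ y in 𝓝 x, DerNear X D y := eventually_eventually_nhds.2 h

lemma DerNear.add {V : Opens N} {X Y : Derivation 𝕜 (SmoothFun 𝕜 E V) (SmoothFun 𝕜 E V)}
    {D D' : Derivation 𝕜 (SmoothFun 𝕜 E N) (SmoothFun 𝕜 E N)} {x : V} (h : DerNear X D x)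
    (h' : DerNear Y D' x) : DerNear (X + Y) (D + D') x := by
  filter_upwards [h, h'] with y h1 h2 F
  simp only [Derivation.add_apply, SmoothFun.add_apply, h1, h2]

lemma DerNear.smul {V : Opens N} {X : Derivation 𝕜 (SmoothFun 𝕜 E V) (SmoothFun 𝕜 E V)}
    {D : Derivation 𝕜 (SmoothFun 𝕜 E N) (SmoothFun 𝕜 E N)} {x : V} (h : DerNear X D x)
    {f : SmoothFun 𝕜 E V} {F : SmoothFun 𝕜 E N} (hf : ∀ᶠ y in 𝓝 x, f y = F y) :
    DerNear (f • X) (F • D) x := by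
  filter_upwards [h, hf] with y h1 h2 G
  simp only [Derivation.smul_apply, smul_eq_mul, SmoothFun.mul_apply, h1, h2]

lemma DerNear.lie {V : Opens N} {X Y : Derivation 𝕜 (SmoothFun 𝕜 E V) (SmoothFun 𝕜 E V)}
    {D D' : Derivation 𝕜 (SmoothFun 𝕜 E N) (SmoothFun 𝕜 E N)} {x : V} (h : DerNear X D x)
    (h' : DerNear Y D' x) : DerNear ⁅X, Y⁆ ⁅D, D'⁆ x := by
  filter_upwards [h.eventually, h'.eventually] with y h1 h2 F
  have e1 : ∀ᶠ z in 𝓝 y, X (SmoothFun.restrict V F) z = D F z := by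
    filter_upwards [h1] with z hz using hz F
  have e2 : ∀ᶠ z in 𝓝 y, Y (SmoothFun.restrict V F) z = D' F z := by
    filter_upwards [h2] with z hz using hz F
  simp only [Derivation.commutator_apply, SmoothFun.sub_apply, h1.apply e2, h2.apply e1]

end basic

/-! ### Restriction of a Lie algebroid to an open subset

A finitely generated projective module `A` over `C^∞(M)` is the module of sections of a vector
bundle, with fibre `A / 𝔪ₓ A` at `x`, where `𝔪ₓ` is the ideal of the functions that vanish at `x`.
The module `A_V` of the sections of this bundle over an open subset `V` consists of the families of
elements of the fibres over `V` which near each point are given by an element of `A`. -/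

section sections

variable {𝕜 E M : Type*} [RCLike 𝕜] [NormedAddCommGroup E] [NormedSpace ℝ E]
    [TopologicalSpace M] [ChartedSpace E M] 

/-- The ideal `𝔪ₓ` of the functions that vanish at `x`. -/
def evalIdeal (𝕜 E : Type*) {M : Type*} [RCLike 𝕜] [NormedAddCommGroup E] [NormedSpace ℝ E]
    [TopologicalSpace M] [ChartedSpace E M] (x : M) : Ideal (SmoothFun 𝕜 E M) where
  carrier := {f | f x = 0}
  add_mem' {f g} hf hg := by
    have h1 : f x = 0 := hf
    have h2 : g x = 0 := hg
    simp [h1, h2]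
  zero_mem' := rfl
  smul_mem' c f hf := by
    have h1 : f x = 0 := hf
    simp [h1]

lemma mem_evalIdeal {x : M} {f : SmoothFun 𝕜 E M} : f ∈ evalIdeal 𝕜 E x ↔ f x = 0 := Iff.rfl

/-- The fibre `A / 𝔪ₓ A` at `x`. -/
def Fiber (𝕜 E A : Type*) {M : Type*} [RCLike 𝕜] [NormedAddCommGroup E] [NormedSpace ℝ E]
    [TopologicalSpace M] [ChartedSpace E M] [AddCommGroup A] [Module (SmoothFun 𝕜 E M) A]
    (x : M) : Type _ :=
  A ⧸ (evalIdeal 𝕜 E x • (⊤ : Submodule (SmoothFun 𝕜 E M) A))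

variable {A : Type*} [AddCommGroup A] [Module (SmoothFun 𝕜 E M) A]

instance (x : M) : AddCommGroup (Fiber 𝕜 E A x) :=
  inferInstanceAs (AddCommGroup (A ⧸ (evalIdeal 𝕜 E x • (⊤ : Submodule (SmoothFun 𝕜 E M) A))))

instance [Module 𝕜 A] [IsScalarTower 𝕜 (SmoothFun 𝕜 E M) A] (x : M) : Module 𝕜 (Fiber 𝕜 E A x) :=
  inferInstanceAs (Module 𝕜 (A ⧸ (evalIdeal 𝕜 E x • (⊤ : Submodule (SmoothFun 𝕜 E M) A))))

variable (𝕜 E) in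
/-- The value at `x` of an element of `A`. -/
def fval (x : M) : A →+ Fiber 𝕜 E A x :=
  (Submodule.mkQ (evalIdeal 𝕜 E x • (⊤ : Submodule (SmoothFun 𝕜 E M) A))).toAddMonoidHom

lemma fval_eq_zero_of_mem {x : M} {f : SmoothFun 𝕜 E M} (hf : f x = 0) (a : A) :
    fval 𝕜 E x (f • a) = 0 :=
  (Submodule.Quotient.mk_eq_zero _).2
    (Submodule.smul_mem_smul (mem_evalIdeal.2 hf) (Submodule.mem_top (x := a)))

variable [Module 𝕜 A] [IsScalarTower 𝕜 (SmoothFun 𝕜 E M) A]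

lemma fval_smul (x : M) (c : 𝕜) (b : A) : fval 𝕜 E x (c • b) = c • fval 𝕜 E x b := rfl

lemma fval_fsmul (x : M) (f : SmoothFun 𝕜 E M) (a : A) :
    fval 𝕜 E x (f • a) = f x • fval 𝕜 E x a := by
  have h : (f - algebraMap 𝕜 (SmoothFun 𝕜 E M) (f x)) x = 0 := by simp
  have := fval_eq_zero_of_mem h a
  rwa [sub_smul, algebraMap_smul, map_sub, sub_eq_zero, fval_smul] at this


variable (𝕜 E A) in
/-- The families of elements of the fibres over `V` that are locally given by elements of `A`. -/
def localSec (V : Opens M) [FiniteDimensional ℝ E] [IsManifold 𝓘(ℝ, E) ∞ M] [T2Space M] :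
    Submodule 𝕜 ((x : V) → Fiber 𝕜 E A (x : M)) where
  carrier := {s | ∀ x, ∃ a : A, ∀ᶠ y in 𝓝 x, s y = fval 𝕜 E (y : M) a}
  add_mem' {s t} hs ht x := by
    obtain ⟨a, ha⟩ := hs x
    obtain ⟨b, hb⟩ := ht x
    refine ⟨a + b, ?_⟩
    filter_upwards [ha, hb] with y h1 h2
    rw [Pi.add_apply, h1, h2, map_add]
  zero_mem' x := ⟨0, by simp⟩
  smul_mem' c s hs x := by
    obtain ⟨a, ha⟩ := hs x
    refine ⟨c • a, ?_⟩
    filter_upwards [ha] with y h1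
    rw [Pi.smul_apply, h1, fval_smul]

end sections

section local_theory

variable {𝕜 E M : Type*} [RCLike 𝕜] [NormedAddCommGroup E] [NormedSpace ℝ E]
    [FiniteDimensional ℝ E]
    [TopologicalSpace M] [ChartedSpace E M] [IsManifold 𝓘(ℝ, E) ∞ M] [T2Space M]

/-- `A_V`, the sections over `V` of the vector bundle defined by `A`. -/
def LocalSec (𝕜 E A : Type*) {M : Type*} [RCLike 𝕜] [NormedAddCommGroup E] [NormedSpace ℝ E]
    [FiniteDimensional ℝ E]
    [TopologicalSpace M] [ChartedSpace E M] [IsManifold 𝓘(ℝ, E) ∞ M] [T2Space M]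
    [AddCommGroup A] [Module (SmoothFun 𝕜 E M) A] [Module 𝕜 A]
    [IsScalarTower 𝕜 (SmoothFun 𝕜 E M) A] (V : Opens M) : Type _ := ↥(localSec 𝕜 E A V)

namespace LocalSec

section module

variable {A : Type*} [AddCommGroup A] [Module (SmoothFun 𝕜 E M) A] [Module 𝕜 A]
    [IsScalarTower 𝕜 (SmoothFun 𝕜 E M) A] {V : Opens M}

instance : AddCommGroup (LocalSec 𝕜 E A V) := inferInstanceAs (AddCommGroup ↥(localSec 𝕜 E A V))
instance : Module 𝕜 (LocalSec 𝕜 E A V) := inferInstanceAs (Module 𝕜 ↥(localSec 𝕜 E A V))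
instance : DFunLike (LocalSec 𝕜 E A V) V (fun x => Fiber 𝕜 E A (x : M)) where
  coe s := s.1
  coe_injective _ _ h := Subtype.ext h

@[ext] lemma ext {s t : LocalSec 𝕜 E A V} (h : ∀ x, s x = t x) : s = t := DFunLike.ext s t h
@[simp] lemma add_apply (s t : LocalSec 𝕜 E A V) (x : V) : (s + t) x = s x + t x := rfl
@[simp] lemma sub_apply (s t : LocalSec 𝕜 E A V) (x : V) : (s - t) x = s x - t x := rfl
@[simp] lemma neg_apply (s : LocalSec 𝕜 E A V) (x : V) : (-s) x = -s x := rfl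
@[simp] lemma zero_apply (x : V) : (0 : LocalSec 𝕜 E A V) x = 0 := rfl
@[simp] lemma smul_apply (c : 𝕜) (s : LocalSec 𝕜 E A V) (x : V) : (c • s) x = c • s x := rfl

/-- `s` agrees with the global element `a` near `x`. -/
def Near (s : LocalSec 𝕜 E A V) (a : A) (x : V) : Prop := ∀ᶠ y in 𝓝 x, s y = fval 𝕜 E (y : M) a

lemma exists_near (s : LocalSec 𝕜 E A V) (x : V) : ∃ a : A, s.Near a x := s.2 x

/-- Bundle a section over `V`. -/
def mk (s : (x : V) → Fiber 𝕜 E A (x : M))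
    (hs : ∀ x, ∃ a : A, ∀ᶠ y in 𝓝 x, s y = fval 𝕜 E (y : M) a) : LocalSec 𝕜 E A V := ⟨s, hs⟩

@[simp] lemma mk_apply (s : (x : V) → Fiber 𝕜 E A (x : M)) (hs) (x : V) :
    (mk s hs : LocalSec 𝕜 E A V) x = s x := rfl

lemma Near.eq {s : LocalSec 𝕜 E A V} {a : A} {x : V} (h : s.Near a x) :
    s x = fval 𝕜 E (x : M) a := h.self_of_nhds

lemma Near.eventually {s : LocalSec 𝕜 E A V} {a : A} {x : V} (h : s.Near a x) :
    ∀ᶠ y in 𝓝 x, s.Near a y := eventually_eventually_nhds.2 h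

lemma Near.add {s t : LocalSec 𝕜 E A V} {a b : A} {x : V} (h : s.Near a x) (h' : t.Near b x) :
    (s + t).Near (a + b) x := by
  filter_upwards [h, h'] with y h1 h2
  rw [add_apply, h1, h2, map_add]

lemma Near.smul {s : LocalSec 𝕜 E A V} {a : A} {x : V} (c : 𝕜) (h : s.Near a x) :
    (c • s).Near (c • a) x := by
  filter_upwards [h] with y h1
  rw [smul_apply, h1, fval_smul]

instance : SMul (SmoothFun 𝕜 E V) (LocalSec 𝕜 E A V) where
  smul f s := mk (fun x => f x • s x) fun x => by
    obtain ⟨F, hF⟩ := exists_ext V f x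
    obtain ⟨a, ha⟩ := s.exists_near x
    refine ⟨F • a, ?_⟩
    filter_upwards [hF, ha] with y h1 h2
    rw [h1, h2, fval_fsmul]

@[simp] lemma fsmul_apply (f : SmoothFun 𝕜 E V) (s : LocalSec 𝕜 E A V) (x : V) :
    (f • s) x = f x • s x := rfl

lemma Near.fsmul {s : LocalSec 𝕜 E A V} {a : A} {x : V} {f : SmoothFun 𝕜 E V}
    {F : SmoothFun 𝕜 E M} (hf : ∀ᶠ y in 𝓝 x, f y = F y) (h : s.Near a x) :
    (f • s).Near (F • a) x := by
  filter_upwards [hf, h] with y h1 h2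
  rw [fsmul_apply, h1, h2, fval_fsmul]

instance : Module (SmoothFun 𝕜 E V) (LocalSec 𝕜 E A V) where
  one_smul s := by ext x; simp
  mul_smul f g s := by ext x; simp [mul_smul]
  smul_zero f := by ext x; simp
  smul_add f s t := by ext x; simp
  add_smul f g s := by ext x; simp [add_smul]
  zero_smul s := by ext x; simp

instance : IsScalarTower 𝕜 (SmoothFun 𝕜 E V) (LocalSec 𝕜 E A V) where
  smul_assoc c f s := by ext x; simp [mul_smul]

variable (V) in
/-- The restriction to `V` of a global section. -/
def ofGlobal (a : A) : LocalSec 𝕜 E A V := mk (fun x => fval 𝕜 E (x : M) a) fun _ =>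
  ⟨a, Eventually.of_forall fun _ => rfl⟩

/-- The restriction of sections from `U` to a smaller open set `V`. -/
def res {U : Opens M} (h : V ≤ U) (s : LocalSec 𝕜 E A U) : LocalSec 𝕜 E A V :=
  mk (fun x => s ⟨x, h x.2⟩) fun x => by
    obtain ⟨a, ha⟩ := s.exists_near ⟨x, h x.2⟩
    exact ⟨a, ((continuous_inclusion h).tendsto x).eventually ha⟩

variable [Module.Projective (SmoothFun 𝕜 E M) A]

/-- An element all of whose values vanish is zero. -/
lemma eq_zero_of_fval {a : A} (h : ∀ x : M, fval 𝕜 E x a = 0) : a = 0 := by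
  obtain ⟨σ, hσ⟩ := Module.projective_def'.1 ‹Module.Projective (SmoothFun 𝕜 E M) A›
  have hz : σ a = 0 := by
    ext i x
    have hx : a ∈ (evalIdeal 𝕜 E x • (⊤ : Submodule (SmoothFun 𝕜 E M) A)) :=
      (Submodule.Quotient.mk_eq_zero _).1 (h x)
    refine Submodule.smul_induction_on (p := fun b => (σ b i) x = 0) hx ?_ ?_
    · intro r hr n _
      have : r x = 0 := hr
      simp [this]
    · intro b c hb hc
      simp [hb, hc]
  have := congrArg (fun l => l a) hσ
  simpa [hz] using this.symm

lemma exists_bump_smul {a : A} {x : M} (h : ∀ᶠ y in 𝓝 x, fval 𝕜 E y a = 0) :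
    ∃ φ : SmoothFun 𝕜 E M, (∀ᶠ y in 𝓝 x, φ y = 1) ∧ φ • a = 0 := by
  obtain ⟨φ, h1, h2⟩ := exists_bump (𝕜 := 𝕜) (E := E) x h
  refine ⟨φ, h1, eq_zero_of_fval (𝕜 := 𝕜) (E := E) (M := M) fun y => ?_⟩
  rw [fval_fsmul]
  by_cases hy : fval 𝕜 E y a = 0
  · rw [hy, smul_zero]
  · have : φ y = 0 := image_eq_zero_of_notMem_tsupport (f := ⇑φ) fun hh => hy (h2 hh)
    rw [this, zero_smul]

lemma Near.sub_zero {s : LocalSec 𝕜 E A V} {a b : A} {x : V} (h : s.Near a x) (h' : s.Near b x) :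
    ∀ᶠ y in 𝓝 (x : M), fval 𝕜 E y (a - b) = 0 := by
  rw [← V.isOpen.isOpenEmbedding_subtypeVal.map_nhds_eq, eventually_map]
  filter_upwards [h, h'] with y h1 h2
  rw [map_sub, ← h1, ← h2, sub_self]

end module

section lie

variable {A : Type*} [LieRing A] [LieAlgebra 𝕜 A] [Module (SmoothFun 𝕜 E M) A]
  [LieRingModule A (SmoothFun 𝕜 E M)] [LieRinehartRing (SmoothFun 𝕜 E M) A]
  [LieRinehartAlgebra 𝕜 (SmoothFun 𝕜 E M) A] [Module.Projective (SmoothFun 𝕜 E M) A]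
  {V : Opens M}

lemma fval_lie_eq_zero {a : A} {x : M} (h : ∀ᶠ y in 𝓝 x, fval 𝕜 E y a = 0) (b : A) :
    fval 𝕜 E x ⁅b, a⁆ = 0 := by
  obtain ⟨φ, h1, h2⟩ := exists_bump_smul h
  have h3 : fval 𝕜 E x ⁅b, φ • a⁆ = 0 := by rw [h2, lie_zero, map_zero]
  rwa [LieRinehartRing.leibniz_smul_right, map_add, fval_fsmul, fval_fsmul, h1.self_of_nhds,
    h.self_of_nhds, one_smul, smul_zero, add_zero] at h3

lemma lie_fun_eq_zero {a : A} {x : M} (h : ∀ᶠ y in 𝓝 x, fval 𝕜 E y a = 0)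
    (f : SmoothFun 𝕜 E M) : ⁅a, f⁆ x = 0 := by
  obtain ⟨φ, h1, h2⟩ := exists_bump_smul h
  have h3 : ⁅φ • a, f⁆ x = 0 := by rw [h2, zero_lie]; rfl
  rwa [LieRinehartRing.lie_smul_eq_mul, SmoothFun.mul_apply, h1.self_of_nhds, one_mul] at h3

lemma fval_lie_congr {s t : LocalSec 𝕜 E A V} {a a' b b' : A} {x : V} (ha : s.Near a x)
    (ha' : s.Near a' x) (hb : t.Near b x) (hb' : t.Near b' x) :
    fval 𝕜 E (x : M) ⁅a, b⁆ = fval 𝕜 E (x : M) ⁅a', b'⁆ := by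
  have h1 := fval_lie_eq_zero (ha.sub_zero ha') b
  have h2 := fval_lie_eq_zero (hb.sub_zero hb') a'
  rw [← lie_skew, map_neg, neg_eq_zero, sub_lie, map_sub, sub_eq_zero] at h1
  rw [lie_sub, map_sub, sub_eq_zero] at h2
  rw [h1, h2]

lemma lie_fun_congr {s : LocalSec 𝕜 E A V} {a a' : A} {x : V} (ha : s.Near a x)
    (ha' : s.Near a' x) {f f' : SmoothFun 𝕜 E M}
    (hf : ∀ᶠ y : V in 𝓝 x, f y = f' y) : ⁅a, f⁆ x = ⁅a', f'⁆ x := by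
  have h1 := lie_fun_eq_zero (ha.sub_zero ha') f
  rw [sub_lie, SmoothFun.sub_apply, sub_eq_zero] at h1
  rw [h1]
  refine der_local (LieRinehartAlgebra.anchor 𝕜 (SmoothFun 𝕜 E M) A a') (x : M) ?_
  rw [← V.isOpen.isOpenEmbedding_subtypeVal.map_nhds_eq, eventually_map]
  exact hf

/-- The bracket on `A_V`: near each point, `[s, t]` is the bracket of any two elements of `A` that
agree with `s` and `t` there. -/
instance : Bracket (LocalSec 𝕜 E A V) (LocalSec 𝕜 E A V) where
  bracket s t := mk (fun x => fval 𝕜 E (x : M) ⁅(s.exists_near x).choose, (t.exists_near x).choose⁆)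
    fun x => ⟨⁅(s.exists_near x).choose, (t.exists_near x).choose⁆, by
      filter_upwards [(s.exists_near x).choose_spec.eventually,
        (t.exists_near x).choose_spec.eventually] with y h1 h2
      exact fval_lie_congr (s.exists_near y).choose_spec h1 (t.exists_near y).choose_spec h2⟩

lemma Near.lie_apply {s t : LocalSec 𝕜 E A V} {a b : A} {x : V} (ha : s.Near a x)
    (hb : t.Near b x) : ⁅s, t⁆ x = fval 𝕜 E (x : M) ⁅a, b⁆ :=
  fval_lie_congr (s.exists_near x).choose_spec ha (t.exists_near x).choose_spec hb

lemma Near.lie {s t : LocalSec 𝕜 E A V} {a b : A} {x : V} (ha : s.Near a x)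
    (hb : t.Near b x) : (⁅s, t⁆ : LocalSec 𝕜 E A V).Near ⁅a, b⁆ x := by
  filter_upwards [ha.eventually, hb.eventually] with y h1 h2 using h1.lie_apply h2

instance : LieRing (LocalSec 𝕜 E A V) where
  add_lie s t u := by
    ext x
    obtain ⟨a, ha⟩ := s.exists_near x
    obtain ⟨b, hb⟩ := t.exists_near x
    obtain ⟨c, hc⟩ := u.exists_near x
    rw [(ha.add hb).lie_apply hc, add_apply, ha.lie_apply hc, hb.lie_apply hc, add_lie, map_add]
  lie_add s t u := by
    ext x
    obtain ⟨a, ha⟩ := s.exists_near x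
    obtain ⟨b, hb⟩ := t.exists_near x
    obtain ⟨c, hc⟩ := u.exists_near x
    rw [ha.lie_apply (hb.add hc), add_apply, ha.lie_apply hc, ha.lie_apply hb, lie_add, map_add]
  lie_self s := by
    ext x
    obtain ⟨a, ha⟩ := s.exists_near x
    rw [ha.lie_apply ha, lie_self, map_zero, zero_apply]
  leibniz_lie s t u := by
    ext x
    obtain ⟨a, ha⟩ := s.exists_near x
    obtain ⟨b, hb⟩ := t.exists_near x
    obtain ⟨c, hc⟩ := u.exists_near x
    rw [ha.lie_apply (hb.lie hc), add_apply, (ha.lie hb).lie_apply hc, hb.lie_apply (ha.lie hc),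
      leibniz_lie, map_add]

instance : LieAlgebra 𝕜 (LocalSec 𝕜 E A V) where
  lie_smul k s t := by
    ext x
    obtain ⟨a, ha⟩ := s.exists_near x
    obtain ⟨b, hb⟩ := t.exists_near x
    rw [ha.lie_apply (hb.smul k), smul_apply, ha.lie_apply hb, lie_smul, fval_smul]

/-- The action of `A_V` on `C^∞(V)`, i.e. the anchor of `A_V`. -/
instance : Bracket (LocalSec 𝕜 E A V) (SmoothFun 𝕜 E V) where
  bracket s f := SmoothFun.mk
    (fun x => (⁅(s.exists_near x).choose, (exists_ext V f x).choose⁆ : SmoothFun 𝕜 E M) x)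
    (smoothFun_of_local fun x => ⟨SmoothFun.restrict V
      ⁅(s.exists_near x).choose, (exists_ext V f x).choose⁆, by
      filter_upwards [(s.exists_near x).choose_spec.eventually,
        eventually_eventually_nhds.2 (exists_ext V f x).choose_spec] with y h1 h2
      refine lie_fun_congr (s.exists_near y).choose_spec h1 ?_
      filter_upwards [h2, (exists_ext V f y).choose_spec] with z h3 h4
      rw [← h3, ← h4]⟩)

lemma Near.act_apply {s : LocalSec 𝕜 E A V} {f : SmoothFun 𝕜 E V} {a : A} {F : SmoothFun 𝕜 E M}
    {x : V} (ha : s.Near a x) (hf : ∀ᶠ y in 𝓝 x, f y = F y) :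
    (⁅s, f⁆ : SmoothFun 𝕜 E V) x = ⁅a, F⁆ x := by
  refine lie_fun_congr (s.exists_near x).choose_spec ha ?_
  filter_upwards [hf, (exists_ext V f x).choose_spec] with z h3 h4
  rw [← h3, ← h4]

lemma Near.act {s : LocalSec 𝕜 E A V} {f : SmoothFun 𝕜 E V} {a : A} {F : SmoothFun 𝕜 E M}
    {x : V} (ha : s.Near a x) (hf : ∀ᶠ y in 𝓝 x, f y = F y) :
    ∀ᶠ y in 𝓝 x, (⁅s, f⁆ : SmoothFun 𝕜 E V) y = (⁅a, F⁆ : SmoothFun 𝕜 E M) y := by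
  filter_upwards [ha.eventually, eventually_eventually_nhds.2 hf] with y h1 h2
    using h1.act_apply h2

instance : LieRingModule (LocalSec 𝕜 E A V) (SmoothFun 𝕜 E V) where
  add_lie s t f := by
    ext x
    obtain ⟨a, ha⟩ := s.exists_near x
    obtain ⟨b, hb⟩ := t.exists_near x
    obtain ⟨F, hF⟩ := exists_ext V f x
    rw [(ha.add hb).act_apply hF, SmoothFun.add_apply, ha.act_apply hF, hb.act_apply hF, add_lie,
      SmoothFun.add_apply]
  lie_add s f g := by
    ext x
    obtain ⟨a, ha⟩ := s.exists_near x
    obtain ⟨F, hF⟩ := exists_ext V f x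
    obtain ⟨G, hG⟩ := exists_ext V g x
    rw [ha.act_apply (F := F + G), SmoothFun.add_apply, ha.act_apply hF, ha.act_apply hG, lie_add,
      SmoothFun.add_apply]
    filter_upwards [hF, hG] with y h1 h2
    simp [h1, h2]
  leibniz_lie s t f := by
    ext x
    obtain ⟨a, ha⟩ := s.exists_near x
    obtain ⟨b, hb⟩ := t.exists_near x
    obtain ⟨F, hF⟩ := exists_ext V f x
    rw [ha.act_apply (hb.act hF), SmoothFun.add_apply, (ha.lie hb).act_apply hF,
      hb.act_apply (ha.act hF), leibniz_lie, SmoothFun.add_apply]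

instance : LieRinehartRing (SmoothFun 𝕜 E V) (LocalSec 𝕜 E A V) where
  lie_smul_eq_mul' f g s := by
    ext x
    obtain ⟨a, ha⟩ := s.exists_near x
    obtain ⟨F, hF⟩ := exists_ext V f x
    obtain ⟨G, hG⟩ := exists_ext V g x
    rw [(ha.fsmul hF).act_apply hG, SmoothFun.mul_apply, ha.act_apply hG,
      LieRinehartRing.lie_smul_eq_mul, SmoothFun.mul_apply, hF.self_of_nhds]
  leibniz_mul_right' s f g := by
    ext x
    obtain ⟨a, ha⟩ := s.exists_near x
    obtain ⟨F, hF⟩ := exists_ext V f x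
    obtain ⟨G, hG⟩ := exists_ext V g x
    have hFG : ∀ᶠ y in 𝓝 x, (f * g) y = (F * G : SmoothFun 𝕜 E M) y := by
      filter_upwards [hF, hG] with y h1 h2
      simp [h1, h2]
    rw [ha.act_apply hFG, LieRinehartRing.leibniz_mul_right]
    simp only [smul_eq_mul, SmoothFun.add_apply, SmoothFun.mul_apply]
    rw [ha.act_apply hG, ha.act_apply hF, hF.self_of_nhds, hG.self_of_nhds]
  leibniz_smul_right' s t f := by
    ext x
    obtain ⟨a, ha⟩ := s.exists_near x
    obtain ⟨b, hb⟩ := t.exists_near x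
    obtain ⟨F, hF⟩ := exists_ext V f x
    rw [ha.lie_apply (hb.fsmul hF), add_apply, fsmul_apply, fsmul_apply, ha.lie_apply hb,
      ha.act_apply hF, hb.eq, LieRinehartRing.leibniz_smul_right, map_add, fval_fsmul, fval_fsmul,
      hF.self_of_nhds]

instance : LieRinehartAlgebra 𝕜 (SmoothFun 𝕜 E V) (LocalSec 𝕜 E A V) where
  smul_lie c s f := by
    ext x
    obtain ⟨a, ha⟩ := s.exists_near x
    obtain ⟨F, hF⟩ := exists_ext V f x
    rw [(ha.smul c).act_apply hF, SmoothFun.smul_apply, ha.act_apply hF, smul_lie,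
      SmoothFun.smul_apply]
  lie_smul c s f := by
    ext x
    obtain ⟨a, ha⟩ := s.exists_near x
    obtain ⟨F, hF⟩ := exists_ext V f x
    rw [ha.act_apply (F := c • F), SmoothFun.smul_apply, ha.act_apply hF, lie_smul,
      SmoothFun.smul_apply]
    filter_upwards [hF] with y h1
    simp [h1]

end lie

end LocalSec

namespace LocalSec

variable {A : Type*} [LieRing A] [LieAlgebra 𝕜 A] [Module (SmoothFun 𝕜 E M) A]
  [LieRingModule A (SmoothFun 𝕜 E M)] [LieRinehartRing (SmoothFun 𝕜 E M) A]
  [LieRinehartAlgebra 𝕜 (SmoothFun 𝕜 E M) A] [Module.Projective (SmoothFun 𝕜 E M) A]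

lemma fval_form_update {q : ℕ}
    (θ : KForm 𝕜 (SmoothFun 𝕜 E M) A q) (x : M)
    (X : Fin q → A) (k : Fin q) {a b : A} (h : fval 𝕜 E x a = fval 𝕜 E x b) :
    fval 𝕜 E x (θ (Function.update X k a) : A) = fval 𝕜 E x (θ (Function.update X k b) : A) := by
  have hx : a - b ∈ (evalIdeal 𝕜 E x • (⊤ : Submodule (SmoothFun 𝕜 E M) A)) :=
    (Submodule.Quotient.mk_eq_zero _).1 (by
      change fval 𝕜 E x (a - b) = 0
      rw [map_sub, h, sub_self])
  have key : ∀ c ∈ (evalIdeal 𝕜 E x • (⊤ : Submodule (SmoothFun 𝕜 E M) A)),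
      fval 𝕜 E x (θ (Function.update X k c) : A) = 0 := by
    intro c hc
    refine Submodule.smul_induction_on hc ?_ ?_
    · intro r hr n _
      rw [θ.map_update_smul, Submodule.coe_smul]
      exact fval_eq_zero_of_mem hr _
    · intro u v hu hv
      rw [θ.map_update_add, Submodule.coe_add, map_add, hu, hv, add_zero]
  have := key _ hx
  rwa [θ.map_update_sub, Submodule.coe_sub, map_sub, sub_eq_zero] at this

lemma fval_form_congr {q : ℕ}
    (θ : KForm 𝕜 (SmoothFun 𝕜 E M) A q) (x : M)
    (X Y : Fin q → A) (h : ∀ k, fval 𝕜 E x (X k) = fval 𝕜 E x (Y k)) :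
    fval 𝕜 E x (θ X : A) = fval 𝕜 E x (θ Y : A) := by
  classical
  have key : ∀ s : Finset (Fin q),
      fval 𝕜 E x (θ (s.piecewise Y X) : A) = fval 𝕜 E x (θ X : A) := by
    intro s
    induction s using Finset.induction_on with
    | empty => simp
    | insert j s hj ih =>
      rw [Finset.piecewise_insert, ← ih]
      conv_rhs => rw [← Function.update_eq_self j (s.piecewise Y X)]
      refine fval_form_update θ x _ j ?_
      rw [Finset.piecewise_eq_of_notMem _ _ _ hj, h]
  rw [← key Finset.univ, Finset.piecewise_univ]

variable {V : Opens M}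

/-- The section `θ(s₁, …, s_q)`. -/
def formVal {q : ℕ} (θ : KForm 𝕜 (SmoothFun 𝕜 E M) A q)
    (s : Fin q → LocalSec 𝕜 E A V) : LocalSec 𝕜 E A V :=
  mk (fun x => fval 𝕜 E (x : M) (θ fun k => ((s k).exists_near x).choose : A)) fun x =>
    ⟨(θ fun k => ((s k).exists_near x).choose : A), by
      filter_upwards [eventually_all.2 fun k => ((s k).exists_near x).choose_spec] with y hy
      refine fval_form_congr θ _ _ _ fun k => ?_
      rw [← hy k, ← ((s k).exists_near y).choose_spec.eq]⟩

lemma formVal_apply {q : ℕ} (θ : KForm 𝕜 (SmoothFun 𝕜 E M) A q)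
    {s : Fin q → LocalSec 𝕜 E A V} {a : Fin q → A} {x : V}
    (h : ∀ k, s k x = fval 𝕜 E (x : M) (a k)) :
    formVal θ s x = fval 𝕜 E (x : M) (θ a : A) := by
  refine fval_form_congr θ _ _ _ fun k => ?_
  rw [← h k, ← ((s k).exists_near x).choose_spec.eq]

lemma formVal_near {q : ℕ} (θ : KForm 𝕜 (SmoothFun 𝕜 E M) A q)
    {s : Fin q → LocalSec 𝕜 E A V} {a : Fin q → A} {x : V} (h : ∀ k, (s k).Near (a k) x) :
    (formVal θ s).Near (θ a : A) x := by
  filter_upwards [eventually_all.2 h] with y hy using formVal_apply θ hy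

lemma formVal_mem {q : ℕ} (θ : KForm 𝕜 (SmoothFun 𝕜 E M) A q)
    (s : Fin q → LocalSec 𝕜 E A V) :
    formVal θ s ∈ kernel 𝕜 (SmoothFun 𝕜 E V) (LocalSec 𝕜 E A V) := by
  rw [mem_kernel]
  intro f
  ext x
  obtain ⟨F, hF⟩ := exists_ext V f x
  rw [(formVal_near θ fun k => ((s k).exists_near x).choose_spec).act_apply hF,
    mem_kernel.1 (θ _).2]
  rfl

variable (V) in
/-- The restriction to `V` of a form in `Ω^q(A, L)`, a form on `A_V` with values in its kernel:
its value at `x` on `s₁, …, s_q` is the value at `x` of `θ(a₁, …, a_q)` for any `aₖ ∈ A` that have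
the same values at `x` as the `sₖ`. -/
def restrictForm {q : ℕ} (θ : KForm 𝕜 (SmoothFun 𝕜 E M) A q) :
    KForm 𝕜 (SmoothFun 𝕜 E V) (LocalSec 𝕜 E A V) q where
  toFun s := ⟨formVal θ s, formVal_mem θ s⟩
  map_update_add' {hd} s i t u := by
    cases Subsingleton.elim hd (instDecidableEqFin q)
    refine Subtype.ext (LocalSec.ext fun x => ?_)
    choose a ha using fun k => (s k).exists_near x
    obtain ⟨b, hb⟩ := t.exists_near x
    obtain ⟨c, hc⟩ := u.exists_near x
    have h : ∀ (t : LocalSec 𝕜 E A V) (b : A), t x = fval 𝕜 E (x : M) b → ∀ k,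
        Function.update s i t k x = fval 𝕜 E (x : M) (Function.update a i b k) := by
      intro t b hb k
      by_cases hk : k = i
      · subst hk; simpa using hb
      · simpa [hk] using (ha k).eq
    rw [Submodule.coe_add, add_apply, formVal_apply θ (h _ _ hb.eq), formVal_apply θ (h _ _ hc.eq),
      formVal_apply θ (h _ _ (hb.add hc).eq), θ.map_update_add, Submodule.coe_add, map_add]
  map_update_smul' {hd} s i f t := by
    cases Subsingleton.elim hd (instDecidableEqFin q)
    refine Subtype.ext (LocalSec.ext fun x => ?_)
    choose a ha using fun k => (s k).exists_near x
    obtain ⟨b, hb⟩ := t.exists_near x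
    obtain ⟨F, hF⟩ := exists_ext V f x
    have h : ∀ (t : LocalSec 𝕜 E A V) (b : A), t x = fval 𝕜 E (x : M) b → ∀ k,
        Function.update s i t k x = fval 𝕜 E (x : M) (Function.update a i b k) := by
      intro t b hb k
      by_cases hk : k = i
      · subst hk; simpa using hb
      · simpa [hk] using (ha k).eq
    rw [Submodule.coe_smul, fsmul_apply, formVal_apply θ (h _ _ hb.eq),
      formVal_apply θ (h _ _ (hb.fsmul hF).eq), θ.map_update_smul, Submodule.coe_smul, fval_fsmul,
      hF.self_of_nhds]
  map_eq_zero_of_eq' s i j h hij := by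
    refine Subtype.ext (LocalSec.ext fun x => ?_)
    choose a ha using fun k => (s k).exists_near x
    have h' : ∀ k, s k x = fval 𝕜 E (x : M) (Function.update a j (a i) k) := by
      intro k
      by_cases hk : k = j
      · subst hk; rw [← h]; simpa using (ha i).eq
      · simpa [hk] using (ha k).eq
    rw [formVal_apply θ h', θ.map_eq_zero_of_eq _ (by simp [hij]) hij, Submodule.coe_zero, map_zero]
    rfl

end LocalSec

/-! ### Local trivializations -/

section triv

variable {g A : Type*} [LieRing g] [LieAlgebra 𝕜 g]
  [LieRing A] [LieAlgebra 𝕜 A] [Module (SmoothFun 𝕜 E M) A]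
  [LieRingModule A (SmoothFun 𝕜 E M)] [LieRinehartRing (SmoothFun 𝕜 E M) A]
  [LieRinehartAlgebra 𝕜 (SmoothFun 𝕜 E M) A] [Module.Projective (SmoothFun 𝕜 E M) A]

variable (𝕜 E g A) in
/-- A local trivialization `(U, Ψ, ∇⁰)` of `A` over `U`: an isomorphism `Ψ : Γ(U × g) ≃ L_U` of Lie
algebras and `C^∞(U)`-modules onto the kernel of `A_U`, and a `C^∞(U)`-linear morphism of Lie
algebras `∇⁰ = conn : Γ(TU) → A_U` which is a section of the anchor, such that
`[∇⁰_X, Ψ(γ)] = Ψ(X · γ)`. -/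
structure LocalTriv (U : Opens M) where
  Ψ : (SmoothFun 𝕜 E U ⊗[𝕜] g) ≃ₗ[SmoothFun 𝕜 E U]
    kernel 𝕜 (SmoothFun 𝕜 E U) (LocalSec 𝕜 E A U)
  conn : Derivation 𝕜 (SmoothFun 𝕜 E U) (SmoothFun 𝕜 E U) →ₗ[SmoothFun 𝕜 E U] LocalSec 𝕜 E A U
  Ψ_lie : ∀ γ η, ⁅(Ψ γ : LocalSec 𝕜 E A U), (Ψ η : LocalSec 𝕜 E A U)⁆ = Ψ ⁅γ, η⁆
  conn_lie : ∀ X Y, ⁅conn X, conn Y⁆ = conn ⁅X, Y⁆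
  anchor_conn : ∀ X, LieRinehartAlgebra.anchor 𝕜 (SmoothFun 𝕜 E U) (LocalSec 𝕜 E A U) (conn X) = X
  conn_Ψ : ∀ X γ, ⁅conn X, (Ψ γ : LocalSec 𝕜 E A U)⁆ = Ψ (derAct g X γ)

namespace LocalTriv

variable {U : Opens M} (T T' : LocalTriv 𝕜 E g A U)

lemma sub_conn_mem (a : LocalSec 𝕜 E A U) :
    a - T.conn (LieRinehartAlgebra.anchor 𝕜 (SmoothFun 𝕜 E U) (LocalSec 𝕜 E A U) a) ∈
      kernel 𝕜 (SmoothFun 𝕜 E U) (LocalSec 𝕜 E A U) := by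
  change LieRinehartAlgebra.anchor 𝕜 (SmoothFun 𝕜 E U) (LocalSec 𝕜 E A U) _ = 0
  rw [map_sub, T.anchor_conn, sub_self]

/-- The isomorphism `S : TLA(U, g) ≃ A_U`, `S(X ⊕ γ) = ∇⁰_X + Ψ(γ)`. -/
def S : TLA 𝕜 (SmoothFun 𝕜 E U) g ≃ₗ[SmoothFun 𝕜 E U] LocalSec 𝕜 E A U where
  toFun Y := T.conn Y.1 + (T.Ψ Y.2 : LocalSec 𝕜 E A U)
  map_add' Y Z := by simp only [Prod.fst_add, Prod.snd_add, map_add, Submodule.coe_add]; abel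
  map_smul' f Y := by
    simp only [Prod.smul_fst, Prod.smul_snd, map_smul, Submodule.coe_smul, smul_add,
      RingHom.id_apply]
  invFun a := (LieRinehartAlgebra.anchor 𝕜 (SmoothFun 𝕜 E U) (LocalSec 𝕜 E A U) a,
    T.Ψ.symm ⟨_, T.sub_conn_mem a⟩)
  left_inv Y := by
    have h1 : LieRinehartAlgebra.anchor 𝕜 (SmoothFun 𝕜 E U) (LocalSec 𝕜 E A U)
        (T.conn Y.1 + (T.Ψ Y.2 : LocalSec 𝕜 E A U)) = Y.1 := by
      have h2 : LieRinehartAlgebra.anchor 𝕜 (SmoothFun 𝕜 E U) (LocalSec 𝕜 E A U) (T.Ψ Y.2) = 0 :=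
        (T.Ψ Y.2).2
      rw [map_add, T.anchor_conn, h2, add_zero]
    refine Prod.ext h1 ?_
    rw [LinearEquiv.symm_apply_eq]
    refine Subtype.ext ?_
    change _ - T.conn _ = _
    rw [h1, add_sub_cancel_left]
  right_inv a := by
    simp

/-- The local expression `θ_loc = Ψ⁻¹ ∘ θ ∘ S` of a form `θ ∈ Ω^q(A, L)`. -/
def localForm {q : ℕ} (θ : KForm 𝕜 (SmoothFun 𝕜 E M) A q) :
    TLAForm 𝕜 (SmoothFun 𝕜 E U) g q :=
  (T.Ψ.symm : _ →ₗ[SmoothFun 𝕜 E U] _).compAlternatingMap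
    ((LocalSec.restrictForm U θ).compLinearMap (T.S : _ →ₗ[SmoothFun 𝕜 E U] _))

/-- `α = Ψ⁻¹ ∘ Ψ'` for two local trivializations over the same open set. -/
def alpha : (SmoothFun 𝕜 E U ⊗[𝕜] g) ≃ₗ[SmoothFun 𝕜 E U] (SmoothFun 𝕜 E U ⊗[𝕜] g) :=
  T'.Ψ.trans T.Ψ.symm

/-- `s = S'⁻¹ ∘ S` for two local trivializations over the same open set. -/
def transition : TLA 𝕜 (SmoothFun 𝕜 E U) g ≃ₗ[SmoothFun 𝕜 E U] TLA 𝕜 (SmoothFun 𝕜 E U) g :=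
  T.S.trans T'.S.symm

/-- The change of trivialization `θ ↦ α ∘ θ ∘ s`, from `T'` to `T`. -/
def alphaHat (q : ℕ) :
    TLAForm 𝕜 (SmoothFun 𝕜 E U) g q →ₗ[SmoothFun 𝕜 E U] TLAForm 𝕜 (SmoothFun 𝕜 E U) g q where
  toFun θ := (alpha T T' : _ →ₗ[SmoothFun 𝕜 E U] _).compAlternatingMap
    (θ.compLinearMap (transition T T' : _ →ₗ[SmoothFun 𝕜 E U] _))
  map_add' θ η := by ext; simp
  map_smul' f θ := by ext; simp

end LocalTriv
end triv

namespace LocalSec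

variable {A : Type*} [LieRing A] [LieAlgebra 𝕜 A] [Module (SmoothFun 𝕜 E M) A]
  [LieRingModule A (SmoothFun 𝕜 E M)] [LieRinehartRing (SmoothFun 𝕜 E M) A]
  [LieRinehartAlgebra 𝕜 (SmoothFun 𝕜 E M) A] [Module.Projective (SmoothFun 𝕜 E M) A]
  {U V : Opens M}

@[simp] lemma res_apply (h : V ≤ U) (s : LocalSec 𝕜 E A U) (x : V) :
    res h s x = s ⟨x, h x.2⟩ := rfl

lemma sum_apply {ι : Type*} (t : Finset ι) (s : ι → LocalSec 𝕜 E A V) (x : V) :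
    (∑ i ∈ t, s i) x = ∑ i ∈ t, s i x := by
  classical
  induction t using Finset.induction_on with
  | empty => rfl
  | insert i t hi ih => rw [Finset.sum_insert hi, Finset.sum_insert hi, add_apply, ih]

lemma Near.res {h : V ≤ U} {s : LocalSec 𝕜 E A U} {a : A} {x : V} (hs : s.Near a ⟨x, h x.2⟩) :
    (LocalSec.res h s).Near a x :=
  ((continuous_inclusion h).tendsto x).eventually hs

lemma Near.act_restrict {s : LocalSec 𝕜 E A V} {a : A} {x : V} (ha : s.Near a x)
    (F : SmoothFun 𝕜 E M) : (⁅s, SmoothFun.restrict V F⁆ : SmoothFun 𝕜 E V) x = ⁅a, F⁆ x :=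
  ha.act_apply (Eventually.of_forall fun _ => rfl)

lemma res_lie (h : V ≤ U) (s t : LocalSec 𝕜 E A U) : res h ⁅s, t⁆ = ⁅res h s, res h t⁆ := by
  ext x
  obtain ⟨a, ha⟩ := s.exists_near ⟨x, h x.2⟩
  obtain ⟨b, hb⟩ := t.exists_near ⟨x, h x.2⟩
  rw [res_apply, ha.lie_apply hb, ha.res.lie_apply hb.res]

lemma res_mem_kernel (h : V ≤ U) {s : LocalSec 𝕜 E A U}
    (hs : s ∈ kernel 𝕜 (SmoothFun 𝕜 E U) (LocalSec 𝕜 E A U)) :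
    res h s ∈ kernel 𝕜 (SmoothFun 𝕜 E V) (LocalSec 𝕜 E A V) := by
  rw [mem_kernel] at hs ⊢
  intro f
  ext x
  obtain ⟨a, ha⟩ := s.exists_near ⟨x, h x.2⟩
  obtain ⟨F, hF⟩ := exists_ext V f x
  rw [ha.res.act_apply hF]
  rw [← ha.act_restrict F, hs]
  rfl

open Classical in
/-- The product `φ s` of a section over `V` with a function supported in `V`, extended by zero
to `U`. -/
def zeroExt (_h : V ≤ U) (φ : SmoothFun 𝕜 E M) (hφ : tsupport φ ⊆ V) (s : LocalSec 𝕜 E A V) :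
    LocalSec 𝕜 E A U :=
  mk (fun y => if hy : (y : M) ∈ V then φ y • s ⟨y, hy⟩ else 0) fun y => by
    by_cases hy : (y : M) ∈ V
    · obtain ⟨a, ha⟩ := s.exists_near ⟨y, hy⟩
      refine ⟨φ • a, ?_⟩
      have h1 : ∀ᶠ z in 𝓝 (y : M), ∀ hz : z ∈ V, s ⟨z, hz⟩ = fval 𝕜 E z a := by
        rw [← V.isOpen.isOpenEmbedding_subtypeVal.map_nhds_eq ⟨y, hy⟩, eventually_map]
        filter_upwards [ha] with z hz _ using hz
      filter_upwards [continuous_subtype_val.continuousAt.eventually h1,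
        continuous_subtype_val.continuousAt.eventually (V.isOpen.mem_nhds hy)] with z hz hz'
      have hz'' : (z : M) ∈ V := hz'
      rw [dif_pos hz'', hz hz'', fval_fsmul]
    · refine ⟨0, ?_⟩
      have h1 : (y : M) ∉ tsupport φ := fun hh => hy (hφ hh)
      have h2 := (notMem_tsupport_iff_eventuallyEq (f := ⇑φ)).1 h1
      filter_upwards [continuous_subtype_val.continuousAt.eventually h2] with z hz
      rw [map_zero]
      split_ifs
      · have hz' : φ z = 0 := hz
        rw [hz', zero_smul]
      · rfl

lemma zeroExt_apply (h : V ≤ U) (φ : SmoothFun 𝕜 E M) (hφ : tsupport φ ⊆ V)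
    (s : LocalSec 𝕜 E A V) (y : V) : zeroExt h φ hφ s ⟨y, h y.2⟩ = φ y • s y := by
  simp only [zeroExt, mk_apply, y.2, dif_pos]

lemma zeroExt_apply_of_notMem (h : V ≤ U) (φ : SmoothFun 𝕜 E M) (hφ : tsupport φ ⊆ V)
    (s : LocalSec 𝕜 E A V) {y : U} (hy : (y : M) ∉ V) : zeroExt h φ hφ s y = 0 := by
  simp only [zeroExt, mk_apply, hy, dif_neg, not_false_eq_true]

lemma res_zeroExt (h : V ≤ U) (φ : SmoothFun 𝕜 E M) (hφ : tsupport φ ⊆ V)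
    (s : LocalSec 𝕜 E A V) : res h (zeroExt h φ hφ s) = SmoothFun.restrict V φ • s := by
  ext x
  exact zeroExt_apply h φ hφ s x

lemma zeroExt_mem_kernel (h : V ≤ U) (φ : SmoothFun 𝕜 E M) (hφ : tsupport φ ⊆ V)
    {s : LocalSec 𝕜 E A V} (hs : s ∈ kernel 𝕜 (SmoothFun 𝕜 E V) (LocalSec 𝕜 E A V)) :
    zeroExt h φ hφ s ∈ kernel 𝕜 (SmoothFun 𝕜 E U) (LocalSec 𝕜 E A U) := by
  rw [mem_kernel]
  intro f
  ext y
  obtain ⟨F, hF⟩ := exists_ext U f y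
  by_cases hy : (y : M) ∈ V
  · obtain ⟨a, ha⟩ := (zeroExt h φ hφ s).exists_near y
    rw [ha.act_apply hF]
    have h1 : (res h (zeroExt h φ hφ s)).Near a ⟨y, hy⟩ := Near.res (h := h) ha
    have h2 := mem_kernel.1 ((kernel 𝕜 (SmoothFun 𝕜 E V) (LocalSec 𝕜 E A V)).smul_mem
      (SmoothFun.restrict V φ) hs) (SmoothFun.restrict V F)
    rw [← res_zeroExt h φ hφ s] at h2
    have h3 := h1.act_restrict F
    rw [h2] at h3
    exact h3.symm
  · have h1 : (y : M) ∉ tsupport φ := fun hh => hy (hφ hh)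
    have h2 := (notMem_tsupport_iff_eventuallyEq (f := ⇑φ)).1 h1
    have h3 : (zeroExt h φ hφ s).Near 0 y := by
      filter_upwards [continuous_subtype_val.continuousAt.eventually h2] with z hz
      rw [map_zero]
      have hz' : φ z = 0 := hz
      by_cases hzV : (z : M) ∈ V
      · have := zeroExt_apply h φ hφ s ⟨z, hzV⟩
        rw [hz', zero_smul] at this
        exact this
      · exact zeroExt_apply_of_notMem h φ hφ s hzV
    rw [h3.act_apply hF, zero_lie]
    rfl

end LocalSec

section restrict

variable {g A : Type*} [LieRing g] [LieAlgebra 𝕜 g]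
  [LieRing A] [LieAlgebra 𝕜 A] [Module (SmoothFun 𝕜 E M) A]
  [LieRingModule A (SmoothFun 𝕜 E M)] [LieRinehartRing (SmoothFun 𝕜 E M) A]
  [LieRinehartAlgebra 𝕜 (SmoothFun 𝕜 E M) A] [Module.Projective (SmoothFun 𝕜 E M) A]
  {U V : Opens M}

namespace LocalTriv

lemma conn_congr (T : LocalTriv 𝕜 E g A U) (h : V ≤ U)
    {X : Derivation 𝕜 (SmoothFun 𝕜 E V) (SmoothFun 𝕜 E V)}
    {D D' : Derivation 𝕜 (SmoothFun 𝕜 E M) (SmoothFun 𝕜 E M)} {x : V} (hD : DerNear X D x)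
    (hD' : DerNear X D' x) :
    T.conn (restrictDer U D) ⟨x, h x.2⟩ = T.conn (restrictDer U D') ⟨x, h x.2⟩ := by
  have h1 : ∀ᶠ y in 𝓝 (x : M), ∀ F, D F y = D' F y := by
    rw [← V.isOpen.isOpenEmbedding_subtypeVal.map_nhds_eq, eventually_map]
    filter_upwards [hD, hD'] with y h1 h2 F
    rw [← h1, ← h2]
  obtain ⟨φ, h2, h3⟩ := exists_bump (𝕜 := 𝕜) (E := E) (x : M) h1
  have h4 : φ • D = φ • D' := by
    ext F y
    change φ y * D F y = φ y * D' F y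
    by_cases hy : ∀ F, D F y = D' F y
    · rw [hy]
    · have : φ y = 0 := image_eq_zero_of_notMem_tsupport (f := ⇑φ) fun hh => hy (h3 hh)
      rw [this, zero_mul, zero_mul]
  have h5 := congrArg (fun D => T.conn (restrictDer U D) ⟨x, h x.2⟩) h4
  simp only [restrictDer_smul, map_smul, LocalSec.fsmul_apply] at h5
  have h6 : SmoothFun.restrict U φ ⟨x, h x.2⟩ = 1 := h2.self_of_nhds
  rwa [h6, one_smul, one_smul] at h5

/-- The restriction of `∇⁰` to `V`: its value at `x` on `X ∈ Γ(TV)` is that of `∇⁰` on any vector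
field that agrees with `X` near `x`. -/
def connRes (T : LocalTriv 𝕜 E g A U) (h : V ≤ U)
    (X : Derivation 𝕜 (SmoothFun 𝕜 E V) (SmoothFun 𝕜 E V)) : LocalSec 𝕜 E A V :=
  LocalSec.mk (fun x => T.conn (restrictDer U (exists_derNear X x).choose) ⟨x, h x.2⟩) fun x => by
    obtain ⟨a, ha⟩ :=
      (T.conn (restrictDer U (exists_derNear X x).choose)).exists_near ⟨x, h x.2⟩
    refine ⟨a, ?_⟩
    filter_upwards [(exists_derNear X x).choose_spec.eventually, ha.res] with y h1 h2
    rw [← h2]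
    exact T.conn_congr h (exists_derNear X y).choose_spec h1

lemma connRes_apply (T : LocalTriv 𝕜 E g A U) (h : V ≤ U)
    {X : Derivation 𝕜 (SmoothFun 𝕜 E V) (SmoothFun 𝕜 E V)}
    {D : Derivation 𝕜 (SmoothFun 𝕜 E M) (SmoothFun 𝕜 E M)} {x : V} (hD : DerNear X D x) :
    T.connRes h X x = T.conn (restrictDer U D) ⟨x, h x.2⟩ :=
  T.conn_congr h (exists_derNear X x).choose_spec hD

lemma connRes_near (T : LocalTriv 𝕜 E g A U) (h : V ≤ U)
    {X : Derivation 𝕜 (SmoothFun 𝕜 E V) (SmoothFun 𝕜 E V)}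
    {D : Derivation 𝕜 (SmoothFun 𝕜 E M) (SmoothFun 𝕜 E M)} {x : V} (hD : DerNear X D x) {a : A}
    (ha : (T.conn (restrictDer U D)).Near a ⟨x, h x.2⟩) : (T.connRes h X).Near a x := by
  filter_upwards [hD.eventually, ha.res] with y h1 h2
  rw [← h2]
  exact T.connRes_apply h h1

/-- The sections `Ψ(1 ⊗ v)` over `V`, for `v ∈ g`. -/
def psiConst (T : LocalTriv 𝕜 E g A U) (h : V ≤ U) :
    g →ₗ[𝕜] kernel 𝕜 (SmoothFun 𝕜 E V) (LocalSec 𝕜 E A V) where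
  toFun v := ⟨LocalSec.res h (T.Ψ (1 ⊗ₜ v) : LocalSec 𝕜 E A U),
    LocalSec.res_mem_kernel h (T.Ψ (1 ⊗ₜ v)).2⟩
  map_add' v w := by
    rw [TensorProduct.tmul_add, map_add]
    rfl
  map_smul' c v := by
    have : (1 : SmoothFun 𝕜 E U) ⊗ₜ[𝕜] (c • v) = algebraMap 𝕜 (SmoothFun 𝕜 E U) c • 1 ⊗ₜ[𝕜] v := by
      rw [TensorProduct.tmul_smul, algebraMap_smul]
    rw [this, map_smul]
    rfl

/-- The restriction of `Ψ` to `V`: the `C^∞(V)`-linear map `f ⊗ v ↦ f Ψ(1 ⊗ v)`. -/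
def psiRes (T : LocalTriv 𝕜 E g A U) (h : V ≤ U) :
    (SmoothFun 𝕜 E V ⊗[𝕜] g) →ₗ[SmoothFun 𝕜 E V]
      kernel 𝕜 (SmoothFun 𝕜 E V) (LocalSec 𝕜 E A V) :=
  LinearMap.liftBaseChange (SmoothFun 𝕜 E V) (T.psiConst h)

lemma psiRes_tmul (T : LocalTriv 𝕜 E g A U) (h : V ≤ U) (f : SmoothFun 𝕜 E V)
    (v : g) : T.psiRes h (f ⊗ₜ v) = f • T.psiConst h v := by
  simp [psiRes]

lemma psiRes_apply (T : LocalTriv 𝕜 E g A U) (h : V ≤ U) {ι : Type*} [Fintype ι]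
    (b : Module.Basis ι 𝕜 g) (γ : SmoothFun 𝕜 E V ⊗[𝕜] g) (x : V) :
    (T.psiRes h γ : LocalSec 𝕜 E A V) x =
      ∑ i, (Algebra.TensorProduct.basis (SmoothFun 𝕜 E V) b).repr γ i x •
        (T.Ψ (1 ⊗ₜ b i) : LocalSec 𝕜 E A U) ⟨x, h x.2⟩ := by
  conv_lhs => rw [← (Algebra.TensorProduct.basis (SmoothFun 𝕜 E V) b).sum_repr γ]
  simp only [map_sum, map_smul, Algebra.TensorProduct.basis_apply, psiRes_tmul, one_smul,
    Submodule.coe_sum, Submodule.coe_smul, LocalSec.sum_apply, LocalSec.fsmul_apply]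
  rfl

lemma Ψ_apply (T : LocalTriv 𝕜 E g A U) {ι : Type*} [Fintype ι]
    (b : Module.Basis ι 𝕜 g) (γ : SmoothFun 𝕜 E U ⊗[𝕜] g) (x : U) :
    (T.Ψ γ : LocalSec 𝕜 E A U) x =
      ∑ i, (Algebra.TensorProduct.basis (SmoothFun 𝕜 E U) b).repr γ i x •
        (T.Ψ (1 ⊗ₜ b i) : LocalSec 𝕜 E A U) x := by
  conv_lhs => rw [← (Algebra.TensorProduct.basis (SmoothFun 𝕜 E U) b).sum_repr γ]
  simp only [map_sum, map_smul, Algebra.TensorProduct.basis_apply,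
    Submodule.coe_sum, Submodule.coe_smul, LocalSec.sum_apply, LocalSec.fsmul_apply]

lemma psiRes_injective [FiniteDimensional 𝕜 g] (T : LocalTriv 𝕜 E g A U)
    (h : V ≤ U) : Function.Injective (T.psiRes h) := by
  rw [injective_iff_map_eq_zero]
  intro γ hγ
  let b := Module.finBasis 𝕜 g
  refine (Algebra.TensorProduct.basis (SmoothFun 𝕜 E V) b).repr.map_eq_zero_iff.1 ?_
  ext i x
  obtain ⟨φ, h1, h2⟩ := exists_bump (𝕜 := 𝕜) (E := E) (x : M) (V.isOpen.mem_nhds x.2)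
  let F := fun j => SmoothFun.restrict U
    (zeroExt V φ h2 ((Algebra.TensorProduct.basis (SmoothFun 𝕜 E V) b).repr γ j))
  let Γ : SmoothFun 𝕜 E U ⊗[𝕜] g :=
    ∑ j, F j • Algebra.TensorProduct.basis (SmoothFun 𝕜 E U) b j
  have hrepr : ∀ j, (Algebra.TensorProduct.basis (SmoothFun 𝕜 E U) b).repr Γ j = F j :=
    fun j => (Algebra.TensorProduct.basis (SmoothFun 𝕜 E U) b).repr_sum_self F ▸ rfl
  have hΓ : T.Ψ Γ = 0 := by
    refine Subtype.ext (LocalSec.ext fun y => ?_)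
    rw [T.Ψ_apply b]
    simp only [hrepr]
    change _ = 0
    by_cases hy : (y : M) ∈ V
    · have h3 := T.psiRes_apply h b γ ⟨y, hy⟩
      rw [hγ] at h3
      have h4 : ∀ j, F j y = φ y *
          (Algebra.TensorProduct.basis (SmoothFun 𝕜 E V) b).repr γ j ⟨y, hy⟩ := fun j =>
        zeroExt_apply V φ h2 _ ⟨y, hy⟩
      simp only [h4, mul_smul, ← Finset.smul_sum]
      rw [← h3]
      exact smul_zero _
    · have h4 : ∀ j, F j y = 0 := fun j => zeroExt_apply_of_notMem V φ h2 _ hy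
      simp only [h4, zero_smul, Finset.sum_const_zero]
  have hΓ0 : Γ = 0 := T.Ψ.map_eq_zero_iff.1 hΓ
  have h5 : F i ⟨x, h x.2⟩ = 0 := by
    rw [← hrepr i, hΓ0, map_zero]
    rfl
  have h6 : F i ⟨x, h x.2⟩ = φ x *
      (Algebra.TensorProduct.basis (SmoothFun 𝕜 E V) b).repr γ i x := zeroExt_apply V φ h2 _ x
  rw [h6, h1.self_of_nhds, one_mul] at h5
  exact h5

lemma coord_congr (T : LocalTriv 𝕜 E g A U) {ι : Type*} [Fintype ι]
    (b : Module.Basis ι 𝕜 g) {t t' : kernel 𝕜 (SmoothFun 𝕜 E U) (LocalSec 𝕜 E A U)} {y : U}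
    (ht : ∀ᶠ z in 𝓝 y, (t : LocalSec 𝕜 E A U) z = (t' : LocalSec 𝕜 E A U) z) (i : ι) :
    (Algebra.TensorProduct.basis (SmoothFun 𝕜 E U) b).repr (T.Ψ.symm t) i y =
      (Algebra.TensorProduct.basis (SmoothFun 𝕜 E U) b).repr (T.Ψ.symm t') i y := by
  obtain ⟨φ, h1, h2⟩ := exists_bump (𝕜 := 𝕜) (E := E) y ht
  have h3 : φ • t = φ • t' := by
    refine Subtype.ext (LocalSec.ext fun z => ?_)
    change φ z • (t : LocalSec 𝕜 E A U) z = φ z • (t' : LocalSec 𝕜 E A U) z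
    by_cases hz : (t : LocalSec 𝕜 E A U) z = (t' : LocalSec 𝕜 E A U) z
    · rw [hz]
    · have : φ z = 0 := image_eq_zero_of_notMem_tsupport (f := ⇑φ) fun hh => hz (h2 hh)
      rw [this, zero_smul, zero_smul]
  have h4 := congrArg (fun u => (Algebra.TensorProduct.basis (SmoothFun 𝕜 E U) b).repr
    (T.Ψ.symm u) i y) h3
  simp only [map_smul, Finsupp.smul_apply, smul_eq_mul, SmoothFun.mul_apply, h1.self_of_nhds,
    one_mul] at h4
  exact h4

lemma psiRes_surjective [FiniteDimensional 𝕜 g] (T : LocalTriv 𝕜 E g A U)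
    (h : V ≤ U) : Function.Surjective (T.psiRes h) := by
  intro s
  let b := Module.finBasis 𝕜 g
  choose φ h1 h2 using fun x : V =>
    exists_bump (𝕜 := 𝕜) (E := E) (x : M) (V.isOpen.mem_nhds x.2)
  let t : V → kernel 𝕜 (SmoothFun 𝕜 E U) (LocalSec 𝕜 E A U) := fun x =>
    ⟨LocalSec.zeroExt h (φ x) (h2 x) (s : LocalSec 𝕜 E A V), LocalSec.zeroExt_mem_kernel h (φ x) (h2 x) s.2⟩
  have ht : ∀ x y : V, (t x : LocalSec 𝕜 E A U) ⟨y, h y.2⟩ = φ x y • (s : LocalSec 𝕜 E A V) y :=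
    fun x y => LocalSec.zeroExt_apply h (φ x) (h2 x) (s : LocalSec 𝕜 E A V) y
  let c := fun (x : V) (i : Fin (Module.finrank 𝕜 g)) =>
    (Algebra.TensorProduct.basis (SmoothFun 𝕜 E U) b).repr (T.Ψ.symm (t x)) i
  have hc : ∀ x i, ∀ᶠ y in 𝓝 x, c y i ⟨y, h y.2⟩ = SmoothFun.res h (c x i) y := by
    intro x i
    have e1 : ∀ᶠ y : V in 𝓝 x, φ x y = 1 := continuous_subtype_val.continuousAt.eventually (h1 x)
    filter_upwards [eventually_eventually_nhds.2 e1] with y hy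
    refine T.coord_congr b ?_ i
    have hopen : Topology.IsOpenEmbedding (Set.inclusion h : V → U) :=
      Opens.isOpenEmbedding_of_le h
    have e2 : ∀ᶠ z : V in 𝓝 y, φ y z = 1 := continuous_subtype_val.continuousAt.eventually (h1 y)
    have e3 := hopen.map_nhds_eq y
    change ∀ᶠ z in 𝓝 (Set.inclusion h y), _
    rw [← e3, eventually_map]
    filter_upwards [hy, e2] with z h3 h4
    exact (ht y z).trans ((by rw [h3, h4] : _ = φ x z • (s : LocalSec 𝕜 E A V) z).trans
      (ht x z).symm)
  let f := fun i => SmoothFun.mk (𝕜 := 𝕜) (E := E) (fun x : V => c x i ⟨x, h x.2⟩)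
    (smoothFun_of_local fun x => ⟨SmoothFun.res h (c x i), hc x i⟩)
  refine ⟨∑ i, f i • Algebra.TensorProduct.basis (SmoothFun 𝕜 E V) b i, ?_⟩
  refine Subtype.ext (LocalSec.ext fun x => ?_)
  rw [T.psiRes_apply h b, (Algebra.TensorProduct.basis (SmoothFun 𝕜 E V) b).repr_sum_self]
  have h5 := T.Ψ_apply b (T.Ψ.symm (t x)) ⟨x, h x.2⟩
  rw [LinearEquiv.apply_symm_apply, ht x x, (h1 x).self_of_nhds, one_smul] at h5
  exact h5.symm

lemma kernel_lie_smul {a b : LocalSec 𝕜 E A V} (ha : a ∈ kernel 𝕜 (SmoothFun 𝕜 E V) (LocalSec 𝕜 E A V))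
    (f : SmoothFun 𝕜 E V) : ⁅a, f • b⁆ = f • ⁅a, b⁆ := by
  rw [LieRinehartRing.leibniz_smul_right, mem_kernel.1 ha, zero_smul, add_zero]

lemma psiRes_lie (T : LocalTriv 𝕜 E g A U) (h : V ≤ U)
    (γ η : SmoothFun 𝕜 E V ⊗[𝕜] g) :
    ⁅(T.psiRes h γ : LocalSec 𝕜 E A V), (T.psiRes h η : LocalSec 𝕜 E A V)⁆
      = T.psiRes h ⁅γ, η⁆ := by
  induction γ with
  | zero => simp
  | add γ γ' h1 h2 => simp only [map_add, add_lie, Submodule.coe_add, h1, h2]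
  | tmul f v =>
    induction η with
    | zero => simp
    | add η η' h1 h2 => simp only [map_add, lie_add, Submodule.coe_add, h1, h2]
    | tmul f' w =>
      rw [LieAlgebra.ExtendScalars.bracket_tmul, psiRes_tmul, psiRes_tmul, psiRes_tmul,
        Submodule.coe_smul, Submodule.coe_smul, Submodule.coe_smul,
        kernel_lie_smul (Submodule.smul_mem _ _ (T.psiConst h v).2), ← lie_skew,
        kernel_lie_smul (T.psiConst h w).2, ← smul_neg, lie_skew, smul_smul, mul_comm]
      change _ • ⁅LocalSec.res h _, LocalSec.res h _⁆ = _ • LocalSec.res h _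
      rw [← LocalSec.res_lie, T.Ψ_lie, LieAlgebra.ExtendScalars.bracket_tmul, one_mul]

lemma act_connRes (T : LocalTriv 𝕜 E g A U) (h : V ≤ U)
    (X : Derivation 𝕜 (SmoothFun 𝕜 E V) (SmoothFun 𝕜 E V)) (f : SmoothFun 𝕜 E V) :
    ⁅T.connRes h X, f⁆ = X f := by
  ext x
  obtain ⟨D, hD⟩ := exists_derNear X x
  obtain ⟨a, ha⟩ := (T.conn (restrictDer U D)).exists_near ⟨x, h x.2⟩
  obtain ⟨F, hF⟩ := exists_ext V f x
  rw [(T.connRes_near h hD ha).act_apply hF, hD.apply hF, ← ha.act_restrict F,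
    ← LieRinehartAlgebra.anchor_apply (R := 𝕜), T.anchor_conn, restrictDer_restrict]
  rfl

lemma connRes_psiRes (T : LocalTriv 𝕜 E g A U) (h : V ≤ U)
    (X : Derivation 𝕜 (SmoothFun 𝕜 E V) (SmoothFun 𝕜 E V)) (γ : SmoothFun 𝕜 E V ⊗[𝕜] g) :
    ⁅T.connRes h X, (T.psiRes h γ : LocalSec 𝕜 E A V)⁆ = T.psiRes h (derAct g X γ) := by
  induction γ with
  | zero => simp
  | add γ γ' h1 h2 => simp only [map_add, lie_add, Submodule.coe_add, h1, h2]
  | tmul f v =>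
    have h0 : ⁅T.connRes h X, (T.psiConst h v : LocalSec 𝕜 E A V)⁆ = 0 := by
      ext x
      obtain ⟨D, hD⟩ := exists_derNear X x
      obtain ⟨a, ha⟩ := (T.conn (restrictDer U D)).exists_near ⟨x, h x.2⟩
      obtain ⟨b, hb⟩ := (T.Ψ (1 ⊗ₜ v) : LocalSec 𝕜 E A U).exists_near ⟨x, h x.2⟩
      have hb' : (T.psiConst h v : LocalSec 𝕜 E A V).Near b x := hb.res
      rw [(T.connRes_near h hD ha).lie_apply hb', ← ha.lie_apply hb, T.conn_Ψ, derAct_tmul,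
        Derivation.map_one_eq_zero, TensorProduct.zero_tmul, map_zero]
      rfl
    rw [derAct_tmul, psiRes_tmul, psiRes_tmul, Submodule.coe_smul, Submodule.coe_smul,
      LieRinehartRing.leibniz_smul_right, h0, smul_zero, zero_add, T.act_connRes h X f]

lemma psiRes_bijective [FiniteDimensional 𝕜 g] (T : LocalTriv 𝕜 E g A U)
    (h : V ≤ U) : Function.Bijective (T.psiRes h) :=
  ⟨T.psiRes_injective h, T.psiRes_surjective h⟩

/-- The restriction of `Ψ` to `V`, as an isomorphism. -/
def psiEquiv [FiniteDimensional 𝕜 g] (T : LocalTriv 𝕜 E g A U) (h : V ≤ U) :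
    (SmoothFun 𝕜 E V ⊗[𝕜] g) ≃ₗ[SmoothFun 𝕜 E V]
      kernel 𝕜 (SmoothFun 𝕜 E V) (LocalSec 𝕜 E A V) :=
  LinearEquiv.ofBijective (T.psiRes h) (T.psiRes_bijective h)

lemma psiEquiv_apply [FiniteDimensional 𝕜 g] (T : LocalTriv 𝕜 E g A U) (h : V ≤ U)
    (γ : SmoothFun 𝕜 E V ⊗[𝕜] g) : T.psiEquiv h γ = T.psiRes h γ := rfl

/-- The restriction of `∇⁰` to `V`, as a linear map. -/
def connLin (T : LocalTriv 𝕜 E g A U) (h : V ≤ U) :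
    Derivation 𝕜 (SmoothFun 𝕜 E V) (SmoothFun 𝕜 E V) →ₗ[SmoothFun 𝕜 E V] LocalSec 𝕜 E A V where
  toFun := T.connRes h
  map_add' X Y := by
    ext x
    obtain ⟨D, hD⟩ := exists_derNear X x
    obtain ⟨D', hD'⟩ := exists_derNear Y x
    rw [LocalSec.add_apply, T.connRes_apply h hD, T.connRes_apply h hD',
      T.connRes_apply h (hD.add hD'), restrictDer_add, map_add, LocalSec.add_apply]
  map_smul' f X := by
    ext x
    obtain ⟨D, hD⟩ := exists_derNear X x
    obtain ⟨F, hF⟩ := exists_ext V f x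
    rw [RingHom.id_apply, LocalSec.fsmul_apply, T.connRes_apply h hD,
      T.connRes_apply h (hD.smul hF), restrictDer_smul, map_smul, LocalSec.fsmul_apply,
      hF.self_of_nhds]
    rfl

lemma connLin_apply (T : LocalTriv 𝕜 E g A U) (h : V ≤ U)
    (X : Derivation 𝕜 (SmoothFun 𝕜 E V) (SmoothFun 𝕜 E V)) : T.connLin h X = T.connRes h X := rfl

lemma connRes_lie (T : LocalTriv 𝕜 E g A U) (h : V ≤ U)
    (X Y : Derivation 𝕜 (SmoothFun 𝕜 E V) (SmoothFun 𝕜 E V)) :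
    ⁅T.connRes h X, T.connRes h Y⁆ = T.connRes h ⁅X, Y⁆ := by
  ext x
  obtain ⟨D, hD⟩ := exists_derNear X x
  obtain ⟨D', hD'⟩ := exists_derNear Y x
  obtain ⟨a, ha⟩ := (T.conn (restrictDer U D)).exists_near ⟨x, h x.2⟩
  obtain ⟨b, hb⟩ := (T.conn (restrictDer U D')).exists_near ⟨x, h x.2⟩
  rw [(T.connRes_near h hD ha).lie_apply (T.connRes_near h hD' hb),
    T.connRes_apply h (hD.lie hD'), restrictDer_lie, ← T.conn_lie, ha.lie_apply hb]

/-- The restriction `(V, Ψ|_V, ∇⁰|_V)` of a local trivialization to a smaller open set `V`. -/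
def restrict [FiniteDimensional 𝕜 g] (T : LocalTriv 𝕜 E g A U) (h : V ≤ U) :
    LocalTriv 𝕜 E g A V where
  Ψ := T.psiEquiv h
  conn := T.connLin h
  Ψ_lie γ η := by
    rw [psiEquiv_apply, psiEquiv_apply, psiEquiv_apply, T.psiRes_lie h γ η]
  conn_lie X Y := by
    rw [connLin_apply, connLin_apply, connLin_apply, T.connRes_lie h X Y]
  anchor_conn X := by
    ext f x
    rw [connLin_apply, LieRinehartAlgebra.anchor_apply, T.act_connRes h X f]
  conn_Ψ X γ := by
    rw [psiEquiv_apply, psiEquiv_apply, connLin_apply, T.connRes_psiRes h X γ]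

/-- For local trivializations `T` over `U` and `T'` over `U'`: the change of trivialization from `T'`
to `T` on `Ω^q_TLA(U ∩ U', g)`. -/
def changeTriv [FiniteDimensional 𝕜 g] {U' : Opens M} (T : LocalTriv 𝕜 E g A U)
    (T' : LocalTriv 𝕜 E g A U') (q : ℕ) :
    TLAForm 𝕜 (SmoothFun 𝕜 E ↥(U ⊓ U')) g q →ₗ[SmoothFun 𝕜 E ↥(U ⊓ U')]
      TLAForm 𝕜 (SmoothFun 𝕜 E ↥(U ⊓ U')) g q :=
  alphaHat (T.restrict inf_le_left) (T'.restrict inf_le_right) q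

end LocalTriv

end restrict

end local_theory

end

end LieAlgd

open LieAlgd

/-! A local trivialization identifies the trivial Lie algebroid with `A_U`: the map `S` is bijective
and respects brackets, because `∇⁰` and `Ψ` do and because `[∇⁰_X, Ψ(γ)] = Ψ(X · γ)` accounts for
the mixed terms. The same relations say that `Ψ` turns the action `X · η + [γ, η]` of `X ⊕ γ` into
the adjoint action of `S(X ⊕ γ)` on the kernel. The Koszul formula uses nothing but a bracket and an
action, so `η ↦ Ψ⁻¹ ∘ η ∘ S` carries one differential to the other (`dTLA_pullForm`). Neither the
Jacobi identity for the trivial algebroid nor `d² = 0` enters.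

For a form on all of `A` there is one further point: `d̂` has to commute with restriction to an open
set (`dHat_restrictForm`). The bracket of sections is local and a `C^∞`-multilinear form depends
only on the values of its arguments, so at each point the formula over the open set can be evaluated
on global elements that agree with the given sections nearby.

A change of trivialization `α̂ = Ψ⁻¹Ψ' ∘ · ∘ S'⁻¹S` turns the expression of a form in one
trivialization into its expression in the other (`alphaHat_pullForm`). Every form of the trivial
algebroid over `U` is the expression of some form on `A_U` (`pullForm_surjective`). Hence `α̂` is
invertible, with the opposite change as inverse, and commutes with the differential. Compatibility
with the graded bracket is separate and purely algebraic: the exterior product is natural and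
`Ψ⁻¹Ψ'` respects brackets (`map_formBracket`). -/

namespace AlternatingMap

/-! ### Naturality of the exterior product. -/

/-- The exterior product of forms is natural in the source and in both targets. -/
lemma domCoprod_map_comp {R ιa ιb M M' N₁ N₂ P₁ P₂ : Type*} [CommSemiring R]
    [Fintype ιa] [Fintype ιb] [DecidableEq ιa] [DecidableEq ιb]
    [AddCommMonoid M] [Module R M] [AddCommMonoid M'] [Module R M']
    [AddCommGroup N₁] [Module R N₁] [AddCommGroup N₂] [Module R N₂]
    [AddCommGroup P₁] [Module R P₁] [AddCommGroup P₂] [Module R P₂]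
    (a : M [⋀^ιa]→ₗ[R] N₁) (b : M [⋀^ιb]→ₗ[R] N₂) (s : M' →ₗ[R] M)
    (f : N₁ →ₗ[R] P₁) (h : N₂ →ₗ[R] P₂) (v : ιa ⊕ ιb → M') :
    (f.compAlternatingMap (a.compLinearMap s)).domCoprod
        (h.compAlternatingMap (b.compLinearMap s)) v =
      TensorProduct.map f h (a.domCoprod b (s ∘ v)) := by
  rw [domCoprod_apply, domCoprod_apply, sum_apply, sum_apply, map_sum]
  refine Finset.sum_congr rfl fun σ _ => ?_
  -- The index `σ` is a permutation modulo those that preserve the two blocks, that is, a shuffle.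
  -- On a representative the summand is a sign times a pure tensor of values.
  induction σ using Quotient.inductionOn' with | _ σ
  rw [domCoprod.summand_mk'', domCoprod.summand_mk'']
  -- The sign acts as a unit of `ℤ` on two different tensor products; once it is `1` or `-1`,
  -- additivity of `TensorProduct.map f h` moves it across.
  rcases Int.units_eq_one_or (Equiv.Perm.sign σ) with e | e <;> rw [e] <;> simp

end AlternatingMap

namespace LieAlgd

/-! ### Koszul formulas and the graded bracket, over an arbitrary commutative algebra. -/

section algebra

variable {𝕜 R : Type*} [Field 𝕜] [CommRing R] [Algebra 𝕜 R]

lemma KoszulDatum.d_apply [CharZero 𝕜] {A W : Type*} [AddCommGroup A] [Module 𝕜 A] [Module R A]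
    [IsScalarTower 𝕜 R A] [AddCommGroup W] [Module 𝕜 W] [Module R W] [IsScalarTower 𝕜 R W]
    (K : KoszulDatum 𝕜 R A W) {q : ℕ} (θ : A [⋀^Fin q]→ₗ[R] W) (X : Fin (q + 1) → A) :
    K.d θ X = ∑ i : Fin (q + 1), (-1) ^ (i : ℕ) • K.act (X i) (θ (i.removeNth X))
      - (2⁻¹ : 𝕜) • ∑ i : Fin (q + 1), (-1) ^ (i : ℕ) •
        ∑ k, θ (Function.update (i.removeNth X) k (K.br (X i) (i.removeNth X k))) := rfl

variable {g : Type*} [LieRing g] [LieAlgebra 𝕜 g]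

/-- The bracket `[X ⊕ γ, Y ⊕ η] = [X, Y] ⊕ (X · η - Y · γ + [γ, η])` of the trivial Lie
algebroid. -/
noncomputable def tlaBracket (X Y : TLA 𝕜 R g) : TLA 𝕜 R g :=
  (⁅X.1, Y.1⁆, derAct g X.1 Y.2 - derAct g Y.1 X.2 + ⁅X.2, Y.2⁆)

/-- `d_TLA` is given by the Koszul formula for the bracket of the trivial Lie algebroid and its
action `(X ⊕ γ) · η = X · η + [γ, η]`. -/
lemma dTLA_apply [CharZero 𝕜] {q : ℕ} (θ : TLAForm 𝕜 R g q) (X : Fin (q + 1) → TLA 𝕜 R g) :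
    dTLA θ X = ∑ i : Fin (q + 1), (-1) ^ (i : ℕ) •
        (derAct g (X i).1 (θ (i.removeNth X)) + ⁅(X i).2, θ (i.removeNth X)⁆)
      - (2⁻¹ : 𝕜) • ∑ i : Fin (q + 1), (-1) ^ (i : ℕ) •
        ∑ k, θ (Function.update (i.removeNth X) k (tlaBracket (X i) (i.removeNth X k))) := by
  have hbr : ∀ Y Z : TLA 𝕜 R g, tlaBracket Y Z =
      (deRhamDatum 𝕜 R g).br Y Z + (chevalleyEilenbergDatum 𝕜 R g).br Y Z := fun Y Z => by
    ext1 <;> simp [tlaBracket, deRhamDatum, chevalleyEilenbergDatum]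
  have hact : ∀ (Y : TLA 𝕜 R g) (γ : R ⊗[𝕜] g), derAct g Y.1 γ + ⁅Y.2, γ⁆ =
      (deRhamDatum 𝕜 R g).act Y γ + (chevalleyEilenbergDatum 𝕜 R g).act Y γ := fun _ _ => rfl
  change (deRhamDatum 𝕜 R g).d θ X + (chevalleyEilenbergDatum 𝕜 R g).d θ X = _
  -- The Koszul formula is additive in the pair (bracket, action): the action occurs linearly, and
  -- the bracket sits in one slot of `θ`, which is additive there. The formulas for `d` and `s'`
  -- therefore add up to that for the sums.
  simp only [KoszulDatum.d_apply, hbr, hact, θ.map_update_add, smul_add, Finset.sum_add_distrib]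
  abel

/-- Separates the two ingredients: the exterior product, with values in a tensor square over `R`,
and the linearised bracket of `R ⊗ g` applied to it. Each has its own naturality. -/
lemma formBracket_apply {p q : ℕ} (θ : TLAForm 𝕜 R g p) (η : TLAForm 𝕜 R g q)
    (X : Fin (p + q) → TLA 𝕜 R g) :
    formBracket θ η X =
      TensorProduct.lift (LinearMap.mk₂ R (fun γ δ : R ⊗[𝕜] g => ⁅γ, δ⁆) add_lie smul_lie lie_add
        fun f γ δ => lie_smul f γ δ) (θ.domCoprod η (X ∘ finSumFinEquiv)) := rfl

/-- The graded bracket never uses the bracket of the source, so `s` need only be linear. All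
Lie-theoretic content is in `hα`. -/
lemma map_formBracket {p q : ℕ} (α : R ⊗[𝕜] g →ₗ[R] R ⊗[𝕜] g)
    (hα : ∀ γ δ, α ⁅γ, δ⁆ = ⁅α γ, α δ⁆) (s : TLA 𝕜 R g →ₗ[R] TLA 𝕜 R g)
    (θ : TLAForm 𝕜 R g p) (η : TLAForm 𝕜 R g q) :
    α.compAlternatingMap ((formBracket θ η).compLinearMap s) =
      formBracket (α.compAlternatingMap (θ.compLinearMap s))
        (α.compAlternatingMap (η.compLinearMap s)) := by
  ext1 X
  rw [formBracket_apply, AlternatingMap.domCoprod_map_comp, LinearMap.compAlternatingMap_apply,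
    AlternatingMap.compLinearMap_apply, formBracket_apply]
  -- Both sides are now linear maps out of the tensor square, applied to the same element, so it
  -- suffices to compare the maps on pure tensors; there the claim is `hα`.
  rw [← LinearMap.comp_apply, ← LinearMap.comp_apply]
  refine LinearMap.congr_fun (TensorProduct.ext' fun γ δ => ?_) _
  exact hα γ δ

section kernel_forms

variable {A : Type*} [LieRing A] [LieAlgebra 𝕜 A] [Module R A] [LieRingModule A R]
  [LieRinehartRing R A] [LieRinehartAlgebra 𝕜 R A]

/-- Once values are taken in `A` instead of the kernel, the adjoint action is the bracket of `A`,
and later computations carry no proofs of membership in the kernel. -/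
lemma coe_dHat_apply [CharZero 𝕜] {q : ℕ} (θ : KForm 𝕜 R A q) (X : Fin (q + 1) → A) :
    (dHat θ X : A) = ∑ i : Fin (q + 1), (-1) ^ (i : ℕ) • ⁅X i, (θ (i.removeNth X) : A)⁆
      - (2⁻¹ : 𝕜) • ∑ i : Fin (q + 1), (-1) ^ (i : ℕ) •
        ∑ k, (θ (Function.update (i.removeNth X) k ⁅X i, i.removeNth X k⁆) : A) := by
  rw [dHat, KoszulDatum.d_apply]
  simp only [adjointDatum, LinearMap.mk₂_apply, Submodule.coe_sub, Submodule.coe_sum]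
  simp

end kernel_forms

end algebra

section local_theory

variable {𝕜 E M : Type*} [RCLike 𝕜] [NormedAddCommGroup E] [NormedSpace ℝ E]
  [FiniteDimensional ℝ E]
  [TopologicalSpace M] [ChartedSpace E M] [IsManifold 𝓘(ℝ, E) ∞ M] [T2Space M]
  {A : Type*} [LieRing A] [LieAlgebra 𝕜 A] [Module (SmoothFun 𝕜 E M) A]
  [LieRingModule A (SmoothFun 𝕜 E M)] [LieRinehartRing (SmoothFun 𝕜 E M) A]
  [LieRinehartAlgebra 𝕜 (SmoothFun 𝕜 E M) A] [Module.Projective (SmoothFun 𝕜 E M) A]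

/-! ### Restriction of forms to an open set. -/

namespace LocalSec

variable {V : Opens M}

lemma coe_restrictForm_apply {q : ℕ} (θ : KForm 𝕜 (SmoothFun 𝕜 E M) A q)
    (s : Fin q → LocalSec 𝕜 E A V) : (restrictForm V θ s : LocalSec 𝕜 E A V) = formVal θ s := rfl

/-- The value at a point, as a linear map over the field. -/
noncomputable def evalAt (x : V) : LocalSec 𝕜 E A V →ₗ[𝕜] Fiber 𝕜 E A (x : M) where
  toFun s := s x
  map_add' _ _ := rfl
  map_smul' _ _ := rfl

/-- The differential commutes with the restriction of forms to an open set. -/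
lemma dHat_restrictForm {q : ℕ} (θ : KForm 𝕜 (SmoothFun 𝕜 E M) A q) :
    dHat (restrictForm V θ) = restrictForm V (dHat θ) := by
  ext1 s
  refine Subtype.ext (LocalSec.ext fun x => ?_)
  -- Agreement near `x`, not only at `x`, is required: the bracket differentiates its arguments and
  -- so depends on their germs.
  choose a ha using fun k => (s k).exists_near x
  -- Evaluation at `x`, for local sections and for elements of `A`, is packaged as linear over `𝕜`
  -- so that it passes through the sums, the signs and the scalar `2⁻¹`.
  let ev := evalAt (𝕜 := 𝕜) (E := E) (A := A) x
  let fv : A →ₗ[𝕜] Fiber 𝕜 E A (x : M) :=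
    { toFun := fval 𝕜 E (x : M), map_add' := map_add _, map_smul' := fval_smul _ }
  have hr : ∀ (i : Fin (q + 1)) k, (i.removeNth s k).Near (i.removeNth a k) x := fun i k => ha _
  -- Here the value of the form is itself bracketed, so its germ must be known; `formVal_near`
  -- supplies it.
  have h1 : ∀ i : Fin (q + 1),
      ev ⁅s i, (restrictForm V θ (i.removeNth s) : LocalSec 𝕜 E A V)⁆ =
        fv ⁅a i, (θ (i.removeNth a) : A)⁆ := fun i =>
    (ha i).lie_apply (formVal_near θ (hr i))
  -- Here the form is applied last, and it depends only on the values of its arguments at `x`; for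
  -- the bracket in slot `k` that value comes from `lie_apply`.
  have h2 : ∀ (i : Fin (q + 1)) (k : Fin q),
      ev (restrictForm V θ (Function.update (i.removeNth s) k ⁅s i, i.removeNth s k⁆) :
        LocalSec 𝕜 E A V) =
        fv (θ (Function.update (i.removeNth a) k ⁅a i, i.removeNth a k⁆) : A) := fun i k => by
    refine formVal_apply θ fun l => ?_
    by_cases hl : l = k
    · subst hl
      simpa using (ha i).lie_apply (hr i l)
    · simpa [hl] using (hr i l).eq
  have h3 : (restrictForm V (dHat θ) s : LocalSec 𝕜 E A V) x = fv (dHat θ a : A) :=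
    formVal_apply _ fun k => (ha k).eq
  rw [h3, show (dHat (restrictForm V θ) s : LocalSec 𝕜 E A V) x =
    ev (dHat (restrictForm V θ) s : LocalSec 𝕜 E A V) from rfl]
  -- Both differentials have the same shape over ordered pairs with the factor `1/2`, so the terms
  -- match one by one without reindexing.
  rw [coe_dHat_apply, coe_dHat_apply]
  simp only [map_sub, map_sum, map_smul, map_zsmul, h1, h2]

end LocalSec

/-! ### Transport of forms along a local trivialization. -/

namespace LocalTriv

variable {g : Type*} [LieRing g] [LieAlgebra 𝕜 g] {U : Opens M}

/-- The expression `Ψ⁻¹ ∘ η ∘ S` in a local trivialization of a form `η` on `A_U` with values in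
its kernel. -/
noncomputable def pullForm (T : LocalTriv 𝕜 E g A U) {q : ℕ}
    (η : KForm 𝕜 (SmoothFun 𝕜 E U) (LocalSec 𝕜 E A U) q) : TLAForm 𝕜 (SmoothFun 𝕜 E U) g q :=
  (T.Ψ.symm : _ →ₗ[SmoothFun 𝕜 E U] _).compAlternatingMap
    (η.compLinearMap (T.S : _ →ₗ[SmoothFun 𝕜 E U] _))

lemma pullForm_apply (T : LocalTriv 𝕜 E g A U) {q : ℕ}
    (η : KForm 𝕜 (SmoothFun 𝕜 E U) (LocalSec 𝕜 E A U) q)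
    (X : Fin q → TLA 𝕜 (SmoothFun 𝕜 E U) g) :
    T.pullForm η X = T.Ψ.symm (η fun k => T.S (X k)) := rfl

/-- The preimage of `θ` is `Ψ ∘ θ ∘ S⁻¹`. This is the reason for working with forms on `A_U`: a form
on `U` need not extend to `M`, so local expressions of global forms would not exhaust the target. -/
lemma pullForm_surjective (T : LocalTriv 𝕜 E g A U) (q : ℕ) :
    Function.Surjective (T.pullForm (q := q)) := fun θ => by
  refine ⟨(T.Ψ : _ →ₗ[SmoothFun 𝕜 E U] _).compAlternatingMap
    (θ.compLinearMap (T.S.symm : _ →ₗ[SmoothFun 𝕜 E U] _)), ?_⟩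
  ext1 X
  rw [pullForm_apply]
  simp

/-- Splits a local expression into restriction to `U`, which is analytic, and transport by `Ψ` and
`S`, which is algebraic. The differential is compared with each separately. -/
lemma localForm_eq_pullForm (T : LocalTriv 𝕜 E g A U) {q : ℕ}
    (θ : KForm 𝕜 (SmoothFun 𝕜 E M) A q) :
    T.localForm θ = T.pullForm (LocalSec.restrictForm U θ) := rfl

lemma S_apply (T : LocalTriv 𝕜 E g A U) (X : TLA 𝕜 (SmoothFun 𝕜 E U) g) :
    T.S X = T.conn X.1 + (T.Ψ X.2 : LocalSec 𝕜 E A U) := rfl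

/-- `S` is a morphism of Lie algebras. -/
lemma S_tlaBracket (T : LocalTriv 𝕜 E g A U) (X Y : TLA 𝕜 (SmoothFun 𝕜 E U) g) :
    T.S (tlaBracket X Y) = ⁅T.S X, T.S Y⁆ := by
  -- The mixed term in the other order, by skew symmetry; it produces the `-Y · γ` in the bracket of
  -- the trivial algebroid.
  have h : ⁅(T.Ψ X.2 : LocalSec 𝕜 E A U), T.conn Y.1⁆ = -(T.Ψ (derAct g Y.1 X.2)) := by
    rw [← lie_skew, T.conn_Ψ]
  simp only [S_apply, tlaBracket, add_lie, lie_add, T.conn_lie, T.conn_Ψ, T.Ψ_lie, h, map_add,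
    map_sub, Submodule.coe_add, Submodule.coe_sub]
  abel

/-- `Ψ` intertwines the action on `g`-valued functions with the adjoint action through `S`. With
`S_tlaBracket` this is all that the Koszul formula needs. -/
lemma lie_S_Ψ (T : LocalTriv 𝕜 E g A U) (X : TLA 𝕜 (SmoothFun 𝕜 E U) g)
    (γ : SmoothFun 𝕜 E U ⊗[𝕜] g) :
    ⁅T.S X, (T.Ψ γ : LocalSec 𝕜 E A U)⁆ = T.Ψ (derAct g X.1 γ + ⁅X.2, γ⁆) := by
  rw [S_apply, add_lie, T.conn_Ψ, T.Ψ_lie, map_add, Submodule.coe_add]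

/-- Passing to the expression in a local trivialization commutes with the differentials. -/
lemma dTLA_pullForm (T : LocalTriv 𝕜 E g A U) {q : ℕ}
    (η : KForm 𝕜 (SmoothFun 𝕜 E U) (LocalSec 𝕜 E A U) q) :
    dTLA (T.pullForm η) = T.pullForm (dHat η) := by
  ext1 X
  -- Moving `Ψ⁻¹` to the other side lets the comparison take place in `A_U`, where both Koszul
  -- formulas involve its bracket.
  rw [pullForm_apply, LinearEquiv.eq_symm_apply]
  refine Subtype.ext ?_
  -- `Ψ` followed by the inclusion of the kernel, with scalars restricted to `𝕜` because the Koszul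
  -- sums contain `2⁻¹ : 𝕜`.
  let ψ : (SmoothFun 𝕜 E U ⊗[𝕜] g) →ₗ[𝕜] LocalSec 𝕜 E A U :=
    ((kernel 𝕜 (SmoothFun 𝕜 E U) (LocalSec 𝕜 E A U)).subtype ∘ₗ
      (T.Ψ : _ →ₗ[SmoothFun 𝕜 E U] _)).restrictScalars 𝕜
  have hψ : ∀ γ, (T.Ψ γ : LocalSec 𝕜 E A U) = ψ γ := fun _ => rfl
  have h0 : ∀ Y, ψ (T.pullForm η Y) = η fun k => T.S (Y k) := fun Y => by
    rw [← hψ, pullForm_apply, LinearEquiv.apply_symm_apply]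
  -- The action terms correspond by `lie_S_Ψ`. Omitting an argument commutes with applying `S` to
  -- each entry by definition.
  have h1 : ∀ i : Fin (q + 1), ψ (derAct g (X i).1 (T.pullForm η (i.removeNth X))
      + ⁅(X i).2, T.pullForm η (i.removeNth X)⁆) =
      ⁅T.S (X i), (η (i.removeNth fun k => T.S (X k)) : LocalSec 𝕜 E A U)⁆ := fun i => by
    rw [← hψ, ← T.lie_S_Ψ, hψ, h0]
    rfl
  -- The bracket terms correspond because `S` respects brackets; only the updated slot `k` needs an
  -- argument.
  have h2 : ∀ (i : Fin (q + 1)) (k : Fin q), ψ (T.pullForm η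
      (Function.update (i.removeNth X) k (tlaBracket (X i) (i.removeNth X k)))) =
      η (Function.update (i.removeNth fun k => T.S (X k)) k
        ⁅T.S (X i), i.removeNth (fun k => T.S (X k)) k⁆) := fun i k => by
    rw [h0]
    congr 2
    funext l
    by_cases hl : l = k
    · subst hl
      simpa [Fin.removeNth] using T.S_tlaBracket (X i) (i.removeNth X l)
    · simp [hl, Fin.removeNth]
  rw [hψ, dTLA_apply, coe_dHat_apply]
  simp only [map_sub, map_sum, map_smul, map_zsmul, h1, h2]

/-! ### Changes of trivialization over a fixed open set. -/

lemma alphaHat_apply (T T' : LocalTriv 𝕜 E g A U) {q : ℕ} (θ : TLAForm 𝕜 (SmoothFun 𝕜 E U) g q)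
    (X : Fin q → TLA 𝕜 (SmoothFun 𝕜 E U) g) :
    alphaHat T T' q θ X = T.Ψ.symm (T'.Ψ (θ fun k => T'.S.symm (T.S (X k)))) := rfl

/-- In `Ψ⁻¹Ψ' ∘ (Ψ'⁻¹ ∘ η ∘ S') ∘ S'⁻¹S` the primed maps cancel. All properties of `α̂` below, apart
from the graded bracket, follow from this. -/
lemma alphaHat_pullForm (T T' : LocalTriv 𝕜 E g A U) {q : ℕ}
    (η : KForm 𝕜 (SmoothFun 𝕜 E U) (LocalSec 𝕜 E A U) q) :
    alphaHat T T' q (T'.pullForm η) = T.pullForm η := by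
  ext1 X
  simp only [alphaHat_apply, pullForm_apply, LinearEquiv.apply_symm_apply]

lemma alphaHat_alphaHat (T T' : LocalTriv 𝕜 E g A U) {q : ℕ}
    (θ : TLAForm 𝕜 (SmoothFun 𝕜 E U) g q) : alphaHat T T' q (alphaHat T' T q θ) = θ := by
  obtain ⟨η, rfl⟩ := T.pullForm_surjective q θ
  rw [alphaHat_pullForm, alphaHat_pullForm]

/-- `Ψ` and `Ψ'` both carry the bracket of `g`-valued functions to the one bracket of `A_U`, so
after applying `Ψ` the two sides agree there. -/
lemma alpha_lie (T T' : LocalTriv 𝕜 E g A U) (γ δ : SmoothFun 𝕜 E U ⊗[𝕜] g) :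
    alpha T T' ⁅γ, δ⁆ = ⁅alpha T T' γ, alpha T T' δ⁆ := by
  change T.Ψ.symm (T'.Ψ ⁅γ, δ⁆) = _
  rw [LinearEquiv.symm_apply_eq]
  refine Subtype.ext ?_
  rw [← T'.Ψ_lie, ← T.Ψ_lie]
  simp [alpha]

/-- A change of trivialization is an isomorphism of graded differential Lie algebras. -/
lemma isGradedDiffLieIso_alphaHat (T T' : LocalTriv 𝕜 E g A U) :
    IsGradedDiffLieIso 𝕜 (SmoothFun 𝕜 E U) g fun q => alphaHat T T' q where
  bijective q := Function.bijective_iff_has_inverse.2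
    ⟨alphaHat T' T q, alphaHat_alphaHat T' T, alphaHat_alphaHat T T'⟩
  map_bracket _ _ θ η := map_formBracket _ (alpha_lie T T') _ θ η
  map_d q θ := by
    -- With `θ` the expression of `η` in `T'`, both sides become the expression of `d̂η` in `T`.
    obtain ⟨η, rfl⟩ := T'.pullForm_surjective q θ
    rw [dTLA_pullForm, alphaHat_pullForm, alphaHat_pullForm, dTLA_pullForm]

/-! ### Local expressions of global forms. -/

/-- The differential of the local expression is the local expression of the differential. -/
lemma dTLA_localForm (T : LocalTriv 𝕜 E g A U) {q : ℕ} (θ : KForm 𝕜 (SmoothFun 𝕜 E M) A q) :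
    dTLA (T.localForm θ) = T.localForm (dHat θ) := by
  rw [localForm_eq_pullForm, dTLA_pullForm, LocalSec.dHat_restrictForm, localForm_eq_pullForm]

/-- The two differentials are the expressions, in `T` and in `T'`, of the single form obtained by
restricting `d̂θ`, so `α̂` relates them. -/
lemma dTLA_localForm_eq_alphaHat (T T' : LocalTriv 𝕜 E g A U) {q : ℕ}
    (θ : KForm 𝕜 (SmoothFun 𝕜 E M) A q) :
    dTLA (T.localForm θ) = alphaHat T T' (q + 1) (dTLA (T'.localForm θ)) := by
  rw [dTLA_localForm, dTLA_localForm, localForm_eq_pullForm, localForm_eq_pullForm,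
    alphaHat_pullForm]

end LocalTriv

end local_theory

end LieAlgd

/-- Let `A` be a transitive Lie algebroid over `M` and `T i` a family of local trivializations of `A`
over open sets `U i` (for instance an atlas). Then `d_TLA θ_loc = Ψ⁻¹ ∘ (d̂ θ) ∘ S` for every form `θ`
with values in the kernel; on `U i ∩ U j` the local expressions satisfy
`d_TLA θ_locⁱ = α̂ⁱⱼ (d_TLA θ_locʲ)`; and `α̂ⁱⱼ` is an isomorphism of graded differential Lie
algebras. -/
theorem mainTheorem2 {𝕜 E M g A ι : Type*} [RCLike 𝕜]
    [NormedAddCommGroup E] [NormedSpace ℝ E] [FiniteDimensional ℝ E]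
    [TopologicalSpace M] [ChartedSpace E M] [IsManifold 𝓘(ℝ, E) ∞ M] [T2Space M]
    [LieRing g] [LieAlgebra 𝕜 g] [FiniteDimensional 𝕜 g]
    [LieRing A] [LieAlgebra 𝕜 A] [Module (SmoothFun 𝕜 E M) A]
    [LieRingModule A (SmoothFun 𝕜 E M)] [LieRinehartRing (SmoothFun 𝕜 E M) A]
    [LieRinehartAlgebra 𝕜 (SmoothFun 𝕜 E M) A]
    [Module.Finite (SmoothFun 𝕜 E M) A] [Module.Projective (SmoothFun 𝕜 E M) A]
    (htransitive : Function.Surjective (LieRinehartAlgebra.anchor 𝕜 (SmoothFun 𝕜 E M) A))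
    (U : ι → Opens M) (T : ∀ i, LocalTriv 𝕜 E g A (U i)) :
    (∀ (i : ι) (q : ℕ) (θ : KForm 𝕜 (SmoothFun 𝕜 E M) A q),
      dTLA ((T i).localForm θ) = (T i).localForm (dHat θ)) ∧
    (∀ (i j : ι) (q : ℕ) (θ : KForm 𝕜 (SmoothFun 𝕜 E M) A q),
      dTLA (((T i).restrict inf_le_left : LocalTriv 𝕜 E g A (U i ⊓ U j)).localForm θ) =
        (T i).changeTriv (T j) (q + 1)
          (dTLA (((T j).restrict inf_le_right : LocalTriv 𝕜 E g A (U i ⊓ U j)).localForm θ))) ∧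
    (∀ i j : ι, IsGradedDiffLieIso 𝕜 (SmoothFun 𝕜 E ↥(U i ⊓ U j)) g
      fun q => (T i).changeTriv (T j) q) := by
  -- `changeTriv` is by definition `alphaHat` for the two restrictions to `U i ⊓ U j`, so the last
  -- two claims are instances of the results for two trivializations over the same open set.
  exact ⟨fun i _ θ => (T i).dTLA_localForm θ,
    fun i j _ θ => LocalTriv.dTLA_localForm_eq_alphaHat _ _ θ,
    fun i j => LocalTriv.isGradedDiffLieIso_alphaHat _ _⟩
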